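/- **Conventions.** $\mathbf{W}^*$ is the category of Archimedean real vector lattices $A$ with a distinguished strong unit $u_A$ (that is, $u_A\ge 0$ and every $a\in A$ satisfies $a\le n u_A$ for some $n\in\mathbb N$), with unit-preserving vector lattice homomorphisms. A $\mathbf W^*$-morphism $f:A\to B$ is an essential embedding if it is injective and every $\mathbf W^*$-morphism $k$ on $B$ with $k\circ f$ injective is itself injective. $YA$ is the compact Hausdorff space of ideals of $A$ maximal with respect to not containing $u_A$, with the hull-kernel topology, and $\nu_A:A\to C(YA)$ is the Yosida embedding, where $\nu_A(a)(M)$ is the unique real $r$ with $a-ru_A\in M$. For $K$ compact Hausdorff, $C(K)$ is the vector lattice of continuous real functions on $K$ with unit the constant function $1$, and $F(K)=\{f\in C(K): f(K)\text{ is finite}\}$. A cover of a compact Hausdorff space $X$ is a compact Hausdorff space $Y$ with a perfect irreducible continuous surjection $f:Y\to X$; irreducible means that $f(F)\ne X$ for every proper closed $F\subset Y$. For covers of $X$, $(Y_1,f_1)\le (Y_2,f_2)$ means that $f_2=f_1\circ g$ for some continuous $g:Y_2\to Y_1$. A space is quasi-$F$ if each of its dense cozero-sets is $C^*$-embedded,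 and almost-$P$ if it has no proper dense cozero-set. $(qFX,\ c_X:qFX\to X)$ is the minimum among the covers of $X$ by quasi-$F$ spaces (unique up to equivalence of covers). Put $\mu(qF)A=C(qF\,YA)$ and $\mu(qF)_A(a)=\nu_A(a)\circ c_{YA}$. For $H\in\mathbf W^*$, let $\mathcal V(H,\mu(qF))$ be the collection of all pairs $(A,f)$, where $A \in \mathbf W^*$ and $f:A\to H$ is an essential embedding such that $f=\theta\circ\mu(qF)_A$ for some $\mathbf W^*$-isomorphism $\theta:\mu(qF)A\to H$ (briefly: $\mu(qF)A=H$). It is preordered by $(A_1,f_1)\le(A_2,f_2)$ if and only if $f_1=f_2\circ g$ for some essential embedding $g:A_1\to A_2$; identifying pairs that lie below each other gives a poset. **Theorem.** (i) $\mathcal V(C(\beta\mathbb N),\mu(qF))$ has minimum $F(\alpha\mathbb N)$, where $\beta\mathbb N$ is the Čech–Stone compactification and $\alpha\mathbb N$ the one-point compactification of the discrete space $\mathbb N$, and $F(\alpha\mathbb N)$ is embedded in $C(\beta\mathbb N)$ by $g\mapsto g\circ\pi$, with $\pi:\beta\mathbb N\to\alpha\mathbb N$ the continuous extension of the inclusion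 $\mathbb N \to\alpha\mathbb N$. (ii) If $K$ is a connected almost-$P$ compact Hausdorff space with more than one point, then $\mathcal V(C(K),\mu(qF))$ has no minimum. (iii) If $K$ is an almost-$P$ compact Hausdorff space that is zero-dimensional (its clopen sets form a base), then $\mathcal V(C(K),\mu(qF))$ has minimum $F(K)$, embedded in $C(K)$ by inclusion. -/

import Mathlib

open Topology

universe u

noncomputable section

/-! ## Covers, quasi-F spaces, almost-P spaces -/

/-- `f : Y → X` is a covering map: a perfect irreducible continuous surjection. -/
structure IsCover {X Y : Type u} [TopologicalSpace X] [TopologicalSpace Y] (f : Y → X) : Prop where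
  continuous : Continuous f
  surjective : Function.Surjective f
  isClosedMap : IsClosedMap f
  isCompact_fiber : ∀ x, IsCompact (f ⁻¹' {x})
  irreducible : ∀ F : Set Y, IsClosed F → F ≠ Set.univ → f '' F ≠ Set.univ

/-- A cozero-set. -/
def IsCozero {X : Type u} [TopologicalSpace X] (S : Set X) : Prop :=
  ∃ f : C(X, ℝ), S = {x | f x ≠ 0}

/-- `S` is `C*`-embedded in `X`: every bounded continuous real function on `S` extends
continuously over `X`. -/
def IsCStarEmbedded {X : Type u} [TopologicalSpace X] (S : Set X) : Prop :=
  ∀ g : BoundedContinuousFunction S ℝ, ∃ G : C(X, ℝ), ∀ s : S, G s = g s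

/-- Quasi-`F` spaces: every dense cozero-set is `C*`-embedded. -/
def IsQuasiF (X : Type u) [TopologicalSpace X] : Prop :=
  ∀ S : Set X, IsCozero S → Dense S → IsCStarEmbedded S

/-- Almost-`P` spaces: there is no proper dense cozero-set. -/
def IsAlmostP (X : Type u) [TopologicalSpace X] : Prop :=
  ∀ S : Set X, IsCozero S → Dense S → S = Set.univ

/-- Zero-dimensional spaces: the clopen sets form a base. -/
def IsZeroDim (X : Type u) [TopologicalSpace X] : Prop :=
  TopologicalSpace.IsTopologicalBasis {s : Set X | IsClopen s}

/-- `(Y, c)` is the quasi-`F` cover of the compact Hausdorff space `X`: the minimum, in the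
order of covers of `X`, among the covers of `X` by quasi-`F` compact Hausdorff spaces.
(This determines `(Y, c)` up to equivalence of covers.) -/
structure IsQuasiFCover {X Y : Type u} [TopologicalSpace X] [TopologicalSpace Y]
    (c : Y → X) : Prop where
  isCover : IsCover c
  isQuasiF : IsQuasiF Y
  minimum : ∀ (Z : Type u) [TopologicalSpace Z] [CompactSpace Z] [T2Space Z] (f : Z → X),
    IsCover f → IsQuasiF Z → ∃ g : Z → Y, Continuous g ∧ f = c ∘ g

/-! ## The category `W*` -/

/-- An Archimedean (real) vector lattice with distinguished strong unit. -/
structure WStar : Type (u + 1) where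
  carrier : Type u
  [addCommGroup : AddCommGroup carrier]
  [lattice : Lattice carrier]
  [isOrderedAddMonoid : IsOrderedAddMonoid carrier]
  [module : Module ℝ carrier]
  [isOrderedModule : IsOrderedModule ℝ carrier]
  unit : carrier
  unit_nonneg : 0 ≤ unit
  exists_le_nsmul_unit : ∀ a : carrier, ∃ n : ℕ, a ≤ n • unit
  archimedean : ∀ a b : carrier, (∀ n : ℕ, n • a ≤ b) → a ≤ 0

instance : CoeSort WStar.{u} (Type u) := ⟨WStar.carrier⟩

attribute [instance] WStar.addCommGroup WStar.lattice WStar.isOrderedAddMonoid WStar.module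
  WStar.isOrderedModule

/-- The morphisms of `W*`: unit-preserving vector lattice homomorphisms. -/
structure WHom (A B : WStar.{u}) extends A →ₗ[ℝ] B where
  map_sup' : ∀ a b : A, toFun (a ⊔ b) = toFun a ⊔ toFun b
  map_inf' : ∀ a b : A, toFun (a ⊓ b) = toFun a ⊓ toFun b
  map_unit' : toFun A.unit = B.unit

instance (A B : WStar.{u}) : CoeFun (WHom A B) (fun _ => A → B) := ⟨fun f => f.toFun⟩

/-- Identity morphism. -/
def WHom.id (A : WStar.{u}) : WHom A A where
  toLinearMap := LinearMap.id
  map_sup' _ _ := rfl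
  map_inf' _ _ := rfl
  map_unit' := rfl

/-- Composition of morphisms. -/
def WHom.comp {A B C : WStar.{u}} (g : WHom B C) (f : WHom A B) : WHom A C where
  toLinearMap := g.toLinearMap.comp f.toLinearMap
  map_sup' a b := (congrArg g (f.map_sup' a b)).trans (g.map_sup' _ _)
  map_inf' a b := (congrArg g (f.map_inf' a b)).trans (g.map_inf' _ _)
  map_unit' := (congrArg g f.map_unit').trans g.map_unit'

/-- Essential embeddings: `f` is injective, and a morphism out of the codomain is injective as
soon as its composite with `f` is. -/
def WHom.IsEssential {A B : WStar.{u}} (f : WHom A B) : Prop :=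
  Function.Injective f ∧
    ∀ (C : WStar.{u}) (k : WHom B C), Function.Injective (k.comp f) → Function.Injective k

theorem WHom.isEssential_id (A : WStar.{u}) : (WHom.id A).IsEssential :=
  ⟨fun _ _ h => h, fun _ _ h => h⟩

theorem WHom.IsEssential.comp {A B C : WStar.{u}} {g : WHom B C} {f : WHom A B}
    (hg : g.IsEssential) (hf : f.IsEssential) : (g.comp f).IsEssential :=
  ⟨fun _ _ h => hf.1 (hg.1 h), fun D k h => hg.2 D k (hf.2 D (k.comp g) h)⟩

/-! ## The objects `C(K)` and `F(K)` -/

theorem exists_le_nsmul_one {X : Type u} [TopologicalSpace X] [CompactSpace X] (f : C(X, ℝ)) :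
    ∃ n : ℕ, f ≤ n • (1 : C(X, ℝ)) := by
  obtain ⟨n, hn⟩ := exists_nat_ge ‖f‖
  refine ⟨n, fun x => ?_⟩
  have h1 : f x ≤ ‖f‖ := (le_abs_self _).trans (f.norm_coe_le_norm x)
  simpa using h1.trans hn

theorem cont_archimedean {X : Type u} [TopologicalSpace X] (a b : C(X, ℝ))
    (h : ∀ n : ℕ, n • a ≤ b) : a ≤ 0 := by
  intro x
  by_contra hx
  have hx' : 0 < a x := not_le.mp hx
  obtain ⟨n, hn⟩ := exists_nat_gt (b x / a x)
  have h1 : (n : ℝ) * a x ≤ b x := by simpa using h n x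
  rw [div_lt_iff₀ hx'] at hn
  linarith

/-- `C(K)`, with the constant function `1` as distinguished unit. -/
def CW (K : Type u) [TopologicalSpace K] [CompactSpace K] : WStar.{u} where
  carrier := C(K, ℝ)
  isOrderedModule :=
    { smul_le_smul_of_nonneg_left := fun _r hr _f _g h x => mul_le_mul_of_nonneg_left (h x) hr
      smul_le_smul_of_nonneg_right := fun _f hf _r _s h x =>
        mul_le_mul_of_nonneg_right h (hf x) }
  unit := 1
  unit_nonneg _ := zero_le_one
  exists_le_nsmul_unit := exists_le_nsmul_one
  archimedean := cont_archimedean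

/-- The subspace of `C(K)` of the functions with finite range. -/
def finRangeSubmodule (K : Type u) [TopologicalSpace K] : Submodule ℝ C(K, ℝ) where
  carrier := {f | (Set.range f).Finite}
  add_mem' {f g} hf hg := by
    refine (hf.image2 (· + ·) hg).subset ?_
    rintro _ ⟨x, rfl⟩
    exact ⟨f x, ⟨x, rfl⟩, g x, ⟨x, rfl⟩, rfl⟩
  zero_mem' := by
    refine (Set.finite_singleton (0 : ℝ)).subset ?_
    rintro _ ⟨x, rfl⟩
    rfl
  smul_mem' r f hf := by
    refine (hf.image (r * ·)).subset ?_
    rintro _ ⟨x, rfl⟩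
    exact ⟨f x, ⟨x, rfl⟩, rfl⟩

theorem finRange_sup {K : Type u} [TopologicalSpace K] {f g : C(K, ℝ)}
    (hf : f ∈ finRangeSubmodule K) (hg : g ∈ finRangeSubmodule K) :
    f ⊔ g ∈ finRangeSubmodule K := by
  refine (Set.Finite.image2 (· ⊔ ·) hf hg).subset ?_
  rintro _ ⟨x, rfl⟩
  exact ⟨f x, ⟨x, rfl⟩, g x, ⟨x, rfl⟩, rfl⟩

theorem finRange_inf {K : Type u} [TopologicalSpace K] {f g : C(K, ℝ)}
    (hf : f ∈ finRangeSubmodule K) (hg : g ∈ finRangeSubmodule K) :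
    f ⊓ g ∈ finRangeSubmodule K := by
  refine (Set.Finite.image2 (· ⊓ ·) hf hg).subset ?_
  rintro _ ⟨x, rfl⟩
  exact ⟨f x, ⟨x, rfl⟩, g x, ⟨x, rfl⟩, rfl⟩

theorem finRange_one (K : Type u) [TopologicalSpace K] :
    (1 : C(K, ℝ)) ∈ finRangeSubmodule K := by
  refine (Set.finite_singleton (1 : ℝ)).subset ?_
  rintro _ ⟨x, rfl⟩
  rfl

/-- `F(K) = {f ∈ C(K) : f(K) is finite}`, with the operations and order of `C(K)` and the
constant function `1` as distinguished unit. -/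
def FW (K : Type u) [TopologicalSpace K] [CompactSpace K] : WStar.{u} :=
  letI : Lattice (finRangeSubmodule K) :=
    Subtype.lattice (fun _ _ hf hg => finRange_sup hf hg) (fun _ _ hf hg => finRange_inf hf hg)
  { carrier := finRangeSubmodule K
    isOrderedAddMonoid := ⟨fun _ _ h c => add_le_add_left (α := C(K, ℝ)) h c,
      fun _ _ h c => add_le_add_right (α := C(K, ℝ)) h c⟩
    isOrderedModule :=
      { smul_le_smul_of_nonneg_left := fun _r hr _f _g h x => mul_le_mul_of_nonneg_left (h x) hr
        smul_le_smul_of_nonneg_right := fun _f hf _r _s h x =>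
          mul_le_mul_of_nonneg_right h (hf x) }
    unit := ⟨1, finRange_one K⟩
    unit_nonneg := fun _ => zero_le_one
    exists_le_nsmul_unit := fun a => exists_le_nsmul_one a.1
    archimedean := fun a b h => cont_archimedean a.1 b.1 h }

/-- For continuous `τ : L → K`, the morphism `C(K) → C(L)`, `f ↦ f ∘ τ`. -/
def CW.pullback {K L : Type u} [TopologicalSpace K] [CompactSpace K] [TopologicalSpace L]
    [CompactSpace L] (τ : C(L, K)) : WHom (CW K) (CW L) where
  toFun (f : C(K, ℝ)) := f.comp τ
  map_add' _ _ := rfl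
  map_smul' _ _ := rfl
  map_sup' _ _ := rfl
  map_inf' _ _ := rfl
  map_unit' := rfl

/-- The inclusion `F(K) → C(K)`. -/
def FW.incl (K : Type u) [TopologicalSpace K] [CompactSpace K] : WHom (FW K) (CW K) where
  toFun := (finRangeSubmodule K).subtype
  map_add' _ _ := rfl
  map_smul' _ _ := rfl
  map_sup' _ _ := rfl
  map_inf' _ _ := rfl
  map_unit' := rfl

/-! ## The Yosida space and the Yosida embedding -/

/-- (Order) ideals of a vector lattice: the solid linear subspaces. -/
def IsSolid {A : WStar.{u}} (M : Submodule ℝ A) : Prop :=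
  ∀ a b : A, |a| ≤ |b| → b ∈ M → a ∈ M

/-- Ideals maximal with respect to not containing the distinguished unit. -/
structure IsUnitMaximal {A : WStar.{u}} (M : Submodule ℝ A) : Prop where
  solid : IsSolid M
  unit_notMem : A.unit ∉ M
  eq_of_le : ∀ J : Submodule ℝ A, IsSolid J → A.unit ∉ J → M ≤ J → J = M

/-- The points of the Yosida space: the unit-maximal ideals. -/
def Yosida (A : WStar.{u}) : Type u := {M : Submodule ℝ A // IsUnitMaximal M}

/-- The hull-kernel topology: the sets `{M | a ∉ M}` generate the open sets. -/
instance (A : WStar.{u}) : TopologicalSpace (Yosida A) :=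
  TopologicalSpace.generateFrom {U | ∃ a : A, U = {M : Yosida A | a ∉ M.1}}

section VectorLattice

variable {A : WStar.{u}}

theorem abs_add_le_add (x y : A) : |x + y| ≤ |x| + |y| := by
  refine sup_le (add_le_add (le_abs_self x) (le_abs_self y)) ?_
  rw [neg_add]
  exact add_le_add (neg_le_abs x) (neg_le_abs y)

theorem abs_smul_le_real (r : ℝ) (x : A) : |r • x| ≤ |r| • |x| := by
  have key : ∀ s : ℝ, s • x ≤ |s| • |x| := by
    intro s
    rcases le_total 0 s with hs | hs
    · rw [abs_of_nonneg hs]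
      exact smul_le_smul_of_nonneg_left (le_abs_self x) hs
    · rw [abs_of_nonpos hs, ← neg_smul_neg]
      exact smul_le_smul_of_nonneg_left (neg_le_abs x) (neg_nonneg.mpr hs)
  refine sup_le (key r) ?_
  have := key (-r)
  rwa [neg_smul, abs_neg] at this

theorem exists_abs_le (a : A) : ∃ N : ℝ, 0 ≤ N ∧ |a| ≤ N • A.unit := by
  obtain ⟨n, hn⟩ := A.exists_le_nsmul_unit |a|
  exact ⟨n, n.cast_nonneg, by rwa [Nat.cast_smul_eq_nsmul]⟩

theorem IsSolid.mem_of_nonneg {M : Submodule ℝ A} (hM : IsSolid M) {a b : A} (ha : 0 ≤ a)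
    (h : a ≤ b) (hb : b ∈ M) : a ∈ M :=
  hM a b (by rwa [abs_of_nonneg ha, abs_of_nonneg (ha.trans h)]) hb

theorem IsSolid.abs_mem {M : Submodule ℝ A} (hM : IsSolid M) {a : A} (ha : a ∈ M) : |a| ∈ M :=
  hM _ a (abs_abs a).le ha

/-- For an ideal `M` and `a ≥ 0`, the ideal generated by `M` and `a`. -/
def adjoinIdeal (M : Submodule ℝ A) (a : A) : Submodule ℝ A where
  carrier := {x | ∃ m ∈ M, 0 ≤ m ∧ ∃ t : ℝ, 0 ≤ t ∧ |x| ≤ m + t • a}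
  add_mem' := by
    rintro x y ⟨m, hm, hm0, t, ht, hx⟩ ⟨m', hm', hm0', t', ht', hy⟩
    refine ⟨m + m', M.add_mem hm hm', add_nonneg hm0 hm0', t + t', add_nonneg ht ht', ?_⟩
    calc |x + y| ≤ |x| + |y| := abs_add_le_add x y
      _ ≤ (m + t • a) + (m' + t' • a) := add_le_add hx hy
      _ = m + m' + (t + t') • a := by rw [add_smul]; abel
  zero_mem' := ⟨0, M.zero_mem, le_rfl, 0, le_rfl, by simp⟩
  smul_mem' := by
    rintro r x ⟨m, hm, hm0, t, ht, hx⟩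
    refine ⟨|r| • m, M.smul_mem _ hm, smul_nonneg (abs_nonneg r) hm0, |r| * t,
      mul_nonneg (abs_nonneg r) ht, (abs_smul_le_real r x).trans ?_⟩
    rw [mul_smul, ← smul_add]
    exact smul_le_smul_of_nonneg_left hx (abs_nonneg r)

theorem IsUnitMaximal.exists_unit_le {M : Submodule ℝ A} (hM : IsUnitMaximal M) {a : A}
    (ha : 0 ≤ a) (haM : a ∉ M) : ∃ m ∈ M, 0 ≤ m ∧ ∃ t : ℝ, 0 ≤ t ∧ A.unit ≤ m + t • a := by
  by_contra hcon
  have hsolid : IsSolid (adjoinIdeal M a) := by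
    rintro x y hxy ⟨m, hm, hm0, t, ht, hy⟩
    exact ⟨m, hm, hm0, t, ht, hxy.trans hy⟩
  have hunit : A.unit ∉ adjoinIdeal M a := by
    rintro ⟨m, hm, hm0, t, ht, h⟩
    exact hcon ⟨m, hm, hm0, t, ht, (le_abs_self _).trans h⟩
  have hle : M ≤ adjoinIdeal M a := fun x hx =>
    ⟨|x|, hM.solid.abs_mem hx, abs_nonneg x, 0, le_rfl, by simp⟩
  apply haM
  rw [← hM.eq_of_le _ hsolid hunit hle]
  exact ⟨0, M.zero_mem, le_rfl, 1, zero_le_one, by simp [abs_of_nonneg ha]⟩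

/-- Unit-maximal ideals are prime. -/
theorem IsUnitMaximal.mem_or_mem {M : Submodule ℝ A} (hM : IsUnitMaximal M) {a b : A}
    (ha : 0 ≤ a) (hb : 0 ≤ b) (hab : a ⊓ b = 0) : a ∈ M ∨ b ∈ M := by
  by_contra! hcon
  obtain ⟨m, hm, hm0, t, ht, h⟩ := hM.exists_unit_le ha hcon.1
  obtain ⟨m', hm', hm0', t', ht', h'⟩ := hM.exists_unit_le hb hcon.2
  have hk : (0 : ℝ) < t + t' + 1 := by positivity
  have h1 : A.unit - (m + m') ≤ (t + t' + 1) • a := by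
    rw [sub_le_iff_le_add']
    refine h.trans (add_le_add (le_add_of_nonneg_right hm0') ?_)
    exact smul_le_smul_of_nonneg_right (by linarith) ha
  have h2 : A.unit - (m + m') ≤ (t + t' + 1) • b := by
    rw [sub_le_iff_le_add']
    refine h'.trans (add_le_add (le_add_of_nonneg_left hm0) ?_)
    exact smul_le_smul_of_nonneg_right (by linarith) hb
  have h3 : A.unit - (m + m') ≤ 0 := by
    refine (le_inf h1 h2).trans_eq ?_
    have := (OrderIso.smulRight (β := A) hk).map_inf a b
    simp only [OrderIso.smulRight_apply, hab, smul_zero] at this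
    exact this.symm
  exact hM.unit_notMem
    (hM.solid.mem_of_nonneg A.unit_nonneg (sub_nonpos.mp h3) (M.add_mem hm hm'))

/-- Modulo a unit-maximal ideal every element is a real multiple of the unit. -/
theorem IsUnitMaximal.exists_sub_smul_mem {M : Submodule ℝ A} (hM : IsUnitMaximal M) (a : A) :
    ∃ r : ℝ, a - r • A.unit ∈ M := by
  obtain ⟨N, hN0, hN⟩ := exists_abs_le a
  set S : Set ℝ := {r | (a - r • A.unit)⁺ ∈ M} with hS
  have hup : ∀ r s, r ∈ S → r ≤ s → s ∈ S := fun r s hr hrs =>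
    hM.solid.mem_of_nonneg (posPart_nonneg _)
      (posPart_mono (sub_le_sub_left (smul_le_smul_of_nonneg_right hrs A.unit_nonneg) a)) hr
  have hne : N ∈ S := by
    have : a - N • A.unit ≤ 0 := sub_nonpos.mpr ((le_abs_self a).trans hN)
    simp [hS, posPart_eq_zero.mpr this]
  have hbdd : BddBelow S := by
    refine ⟨-N, fun r hr => ?_⟩
    by_contra! hlt
    have h1 : (-N - r) • A.unit ≤ a - r • A.unit := by
      rw [sub_smul]
      refine sub_le_sub_right ?_ _
      rw [neg_smul]
      exact neg_le.mp ((neg_le_abs a).trans hN)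
    have hpos : 0 < -N - r := by linarith
    have h2 : (-N - r) • A.unit ∈ M := hM.solid.mem_of_nonneg
      (smul_nonneg hpos.le A.unit_nonneg) (h1.trans (le_posPart _)) hr
    exact hM.unit_notMem ((M.smul_mem_iff hpos.ne').mp h2)
  refine ⟨sInf S, ?_⟩
  by_contra hnot
  have hnot' : |a - sInf S • A.unit| ∉ M := fun h =>
    hnot (hM.solid _ _ (abs_abs _).ge h)
  obtain ⟨m, hm, hm0, t, ht, h⟩ := hM.exists_unit_le (abs_nonneg _) hnot'
  obtain ⟨ε, hε, htε⟩ : ∃ ε : ℝ, 0 < ε ∧ t * ε < 1 := by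
    refine ⟨1 / (t + 1), by positivity, ?_⟩
    rw [mul_one_div, div_lt_one (by positivity)]
    linarith
  have hp : (a - (sInf S + ε) • A.unit)⁺ ∈ M := by
    obtain ⟨s, hs, hlt⟩ := exists_lt_of_csInf_lt ⟨N, hne⟩ (lt_add_of_pos_right (sInf S) hε)
    exact hup s _ hs hlt.le
  have hn : (a - (sInf S - ε) • A.unit)⁻ ∈ M := by
    refine (hM.mem_or_mem (posPart_nonneg _) (negPart_nonneg _)
      (posPart_inf_negPart_eq_zero (a - (sInf S - ε) • A.unit))).resolve_left fun hmem => ?_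
    have := csInf_le hbdd (show sInf S - ε ∈ S from hmem)
    linarith
  have hbound : |a - sInf S • A.unit| ≤
      ((a - (sInf S + ε) • A.unit)⁺ + (a - (sInf S - ε) • A.unit)⁻) + ε • A.unit := by
    refine sup_le ?_ ?_
    · calc a - sInf S • A.unit = (a - (sInf S + ε) • A.unit) + ε • A.unit := by
            rw [add_smul]; abel
        _ ≤ _ := add_le_add_left ((le_posPart _).trans
            (le_add_of_nonneg_right (negPart_nonneg _))) _
    · calc -(a - sInf S • A.unit) = -(a - (sInf S - ε) • A.unit) + ε • A.unit := by
            rw [sub_smul]; abel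
        _ ≤ _ := add_le_add_left ((neg_le_negPart _).trans
            (le_add_of_nonneg_left (posPart_nonneg _))) _
  set p := (a - (sInf S + ε) • A.unit)⁺ + (a - (sInf S - ε) • A.unit)⁻ with hpdef
  have hpM : p ∈ M := M.add_mem hp hn
  have hfin : (1 - t * ε) • A.unit ≤ m + t • p := by
    rw [sub_smul, one_smul, sub_le_iff_le_add, mul_smul, add_assoc, ← smul_add]
    exact h.trans (add_le_add_right (smul_le_smul_of_nonneg_left hbound ht) _)
  have hpos : 0 < 1 - t * ε := by linarith
  have := hM.solid.mem_of_nonneg (smul_nonneg hpos.le A.unit_nonneg) hfin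
    (M.add_mem hm (M.smul_mem t hpM))
  exact hM.unit_notMem ((M.smul_mem_iff hpos.ne').mp this)

theorem IsUnitMaximal.eq_of_sub_smul_mem {M : Submodule ℝ A} (hM : IsUnitMaximal M) {a : A}
    {r s : ℝ} (hr : a - r • A.unit ∈ M) (hs : a - s • A.unit ∈ M) : r = s := by
  by_contra hne
  have h : (s - r) • A.unit ∈ M := by
    have := M.sub_mem hr hs
    rwa [sub_sub_sub_cancel_left, ← sub_smul] at this
  exact hM.unit_notMem ((M.smul_mem_iff (sub_ne_zero.mpr (Ne.symm hne))).mp h)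

/-- The value of `a` at the point `M` of the Yosida space: the unique real number `r` with
`a - r • unit ∈ M`. -/
def yosidaVal (a : A) (M : Yosida A) : ℝ := (M.2.exists_sub_smul_mem a).choose

theorem yosidaVal_spec (a : A) (M : Yosida A) : a - yosidaVal a M • A.unit ∈ M.1 :=
  (M.2.exists_sub_smul_mem a).choose_spec

theorem yosidaVal_eq {a : A} {M : Yosida A} {r : ℝ} (h : a - r • A.unit ∈ M.1) :
    yosidaVal a M = r :=
  M.2.eq_of_sub_smul_mem (yosidaVal_spec a M) h

theorem yosidaVal_eq_zero {a : A} {M : Yosida A} : yosidaVal a M = 0 ↔ a ∈ M.1 := by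
  constructor
  · intro h
    have := yosidaVal_spec a M
    rwa [h, zero_smul, sub_zero] at this
  · intro h
    exact yosidaVal_eq (by rwa [zero_smul, sub_zero])

theorem yosidaVal_unit (M : Yosida A) : yosidaVal A.unit M = 1 :=
  yosidaVal_eq (by rw [one_smul, sub_self]; exact M.1.zero_mem)

theorem yosidaVal_add (a b : A) (M : Yosida A) :
    yosidaVal (a + b) M = yosidaVal a M + yosidaVal b M := by
  apply yosidaVal_eq
  rw [add_smul, add_sub_add_comm]
  exact M.1.add_mem (yosidaVal_spec a M) (yosidaVal_spec b M)

theorem yosidaVal_smul (r : ℝ) (a : A) (M : Yosida A) :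
    yosidaVal (r • a) M = r * yosidaVal a M := by
  apply yosidaVal_eq
  rw [mul_smul, ← smul_sub]
  exact M.1.smul_mem r (yosidaVal_spec a M)

theorem smul_unit_sup (r s : ℝ) : r • A.unit ⊔ s • A.unit = (r ⊔ s) • A.unit := by
  rcases le_total r s with h | h
  · rw [sup_eq_right.mpr h, sup_eq_right.mpr (smul_le_smul_of_nonneg_right h A.unit_nonneg)]
  · rw [sup_eq_left.mpr h, sup_eq_left.mpr (smul_le_smul_of_nonneg_right h A.unit_nonneg)]

theorem yosidaVal_sup (a b : A) (M : Yosida A) :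
    yosidaVal (a ⊔ b) M = yosidaVal a M ⊔ yosidaVal b M := by
  apply yosidaVal_eq
  rw [← smul_unit_sup]
  have h1 := abs_sup_sub_sup_le_abs a (yosidaVal a M • A.unit) b
  have h2 := abs_sup_sub_sup_le_abs b (yosidaVal b M • A.unit) (yosidaVal a M • A.unit)
  rw [sup_comm b, sup_comm _ (yosidaVal a M • A.unit)] at h2
  have h := add_le_add h1 h2
  refine M.2.solid _ _ ?_ (M.1.add_mem (M.2.solid.abs_mem (yosidaVal_spec a M))
    (M.2.solid.abs_mem (yosidaVal_spec b M)))
  rw [abs_of_nonneg (add_nonneg (abs_nonneg (a - _)) (abs_nonneg (b - _)))]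
  refine le_trans ?_ h
  refine le_trans ?_ (abs_add_le_add _ _)
  rw [sub_add_sub_cancel]

theorem yosidaVal_neg (a : A) (M : Yosida A) : yosidaVal (-a) M = -yosidaVal a M := by
  have := yosidaVal_smul (-1) a M
  simpa using this

theorem yosidaVal_inf (a b : A) (M : Yosida A) :
    yosidaVal (a ⊓ b) M = yosidaVal a M ⊓ yosidaVal b M := by
  have h := yosidaVal_sup (-a) (-b) M
  rw [← neg_inf, yosidaVal_neg, yosidaVal_neg, yosidaVal_neg, ← neg_inf] at h
  exact neg_injective h

theorem continuous_yosidaVal (a : A) : Continuous (yosidaVal a) := by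
  have hopen : ∀ b : A, IsOpen {M : Yosida A | yosidaVal b M ≠ 0} := fun b =>
    TopologicalSpace.isOpen_generateFrom_of_mem
      ⟨b, Set.ext fun M => not_congr yosidaVal_eq_zero⟩
  have hIoi : ∀ (b : A) (t : ℝ), IsOpen {M : Yosida A | t < yosidaVal b M} := by
    intro b t
    convert hopen ((b + (-t) • A.unit) ⊔ 0) using 3 with M
    rw [yosidaVal_sup, yosidaVal_add, yosidaVal_smul, yosidaVal_unit,
      yosidaVal_eq_zero.mpr M.1.zero_mem]
    rw [Ne, sup_eq_right, not_le]
    constructor <;> intro h <;> linarith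
  rw [continuous_iff_continuousAt]
  intro M
  refine tendsto_order.mpr ⟨fun t ht => (hIoi a t).mem_nhds ht, fun t ht => ?_⟩
  have := (hIoi (-a) (-t)).mem_nhds (show -t < yosidaVal (-a) M by rw [yosidaVal_neg]; linarith)
  filter_upwards [this] with N hN
  simp only [yosidaVal_neg] at hN
  linarith

theorem yosida_ext {M N : Yosida A} (h : ∀ a : A, yosidaVal a M = yosidaVal a N) : M = N := by
  apply Subtype.ext
  ext a
  rw [← yosidaVal_eq_zero, ← yosidaVal_eq_zero, h a]

instance : T2Space (Yosida A) := by
  refine ⟨fun M N hne => ?_⟩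
  obtain ⟨a, ha⟩ : ∃ a : A, yosidaVal a M ≠ yosidaVal a N := by
    by_contra! h
    exact hne (yosida_ext h)
  exact separated_by_continuous (continuous_yosidaVal a) ha

/-- The real-valued unital vector lattice homomorphisms on `A`, as a set of functions. -/
def charSet (A : WStar.{u}) : Set (A → ℝ) :=
  {φ | (∀ a b, φ (a + b) = φ a + φ b) ∧ (∀ (r : ℝ) a, φ (r • a) = r * φ a) ∧
    (∀ a b, φ (a ⊔ b) = φ a ⊔ φ b) ∧ φ A.unit = 1}

theorem range_yosidaVal :
    Set.range (fun (M : Yosida A) (a : A) => yosidaVal a M) = charSet A := by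
  apply Set.Subset.antisymm
  · rintro _ ⟨M, rfl⟩
    exact ⟨fun a b => yosidaVal_add a b M, fun r a => yosidaVal_smul r a M,
      fun a b => yosidaVal_sup a b M, yosidaVal_unit M⟩
  · rintro φ ⟨hadd, hsmul, hsup, hunit⟩
    have hneg : ∀ a, φ (-a) = -φ a := fun a => by simpa using hsmul (-1) a
    have habs : ∀ a, φ |a| = |φ a| := fun a => by
      change φ (a ⊔ -a) = φ a ⊔ -φ a
      rw [hsup, hneg]
    have hmono : ∀ a b, a ≤ b → φ a ≤ φ b := fun a b hab => by
      have := hsup a b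
      rw [sup_eq_right.mpr hab] at this
      exact sup_eq_right.mp this.symm
    let L : A →ₗ[ℝ] ℝ := { toFun := φ, map_add' := hadd, map_smul' := hsmul }
    have hL : ∀ a, a ∈ LinearMap.ker L ↔ φ a = 0 := fun a => LinearMap.mem_ker
    have hker : IsUnitMaximal (LinearMap.ker L) := by
      refine ⟨fun a b hab hb => ?_, fun h => ?_, fun J _ hJ hle => le_antisymm (fun a ha => ?_) hle⟩
      · rw [hL] at hb ⊢
        have := hmono _ _ hab
        rw [habs, habs, hb, abs_zero] at this
        exact abs_eq_zero.mp (le_antisymm this (abs_nonneg _))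
      · rw [hL, hunit] at h
        exact one_ne_zero h
      · rw [hL]
        by_contra hne
        have h1 : a - φ a • A.unit ∈ LinearMap.ker L := by
          rw [hL, sub_eq_add_neg, hadd, hneg, hsmul, hunit]
          ring
        have h2 : φ a • A.unit ∈ J := by
          have := J.sub_mem ha (hle h1)
          rwa [sub_sub_cancel] at this
        exact hJ ((J.smul_mem_iff hne).mp h2)
    refine ⟨⟨LinearMap.ker L, hker⟩, funext fun a => ?_⟩
    apply yosidaVal_eq
    change a - φ a • A.unit ∈ LinearMap.ker L
    rw [hL, sub_eq_add_neg, hadd, hneg, hsmul, hunit]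
    ring

theorem isInducing_yosidaVal :
    IsInducing (fun (M : Yosida A) (a : A) => yosidaVal a M) := by
  refine ⟨le_antisymm ?_ ?_⟩
  · exact (continuous_pi fun a => continuous_yosidaVal a).le_induced
  · refine le_generateFrom ?_
    rintro _ ⟨a, rfl⟩
    refine ⟨{φ | φ a ≠ 0}, isOpen_ne.preimage (continuous_apply a), ?_⟩
    exact Set.ext fun M => not_congr yosidaVal_eq_zero

theorem isClosed_charSet (A : WStar.{u}) : IsClosed (charSet A) := by
  have hc : ∀ a : A, Continuous fun φ : A → ℝ => φ a := fun a => continuous_apply a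
  simp only [charSet, Set.ofPred_and, Set.ofPred_forall]
  refine IsClosed.inter ?_ (IsClosed.inter ?_ (IsClosed.inter ?_ ?_))
  · exact isClosed_iInter fun a => isClosed_iInter fun b =>
      isClosed_eq (hc _) ((hc a).add (hc b))
  · exact isClosed_iInter fun r => isClosed_iInter fun a =>
      isClosed_eq (hc _) (continuous_const.mul (hc a))
  · exact isClosed_iInter fun a => isClosed_iInter fun b =>
      isClosed_eq (hc _) ((hc a).sup (hc b))
  · exact isClosed_eq (hc _) continuous_const

theorem isCompact_charSet (A : WStar.{u}) : IsCompact (charSet A) := by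
  choose N hN0 hN using fun a : A => exists_abs_le a
  refine IsCompact.of_isClosed_subset
    (isCompact_univ_pi fun a : A => isCompact_Icc (a := -N a) (b := N a))
    (isClosed_charSet A) ?_
  rw [← range_yosidaVal]
  rintro _ ⟨M, rfl⟩ a _
  have hle : ∀ b : A, b ≤ N a • A.unit → yosidaVal b M ≤ N a := fun b hb => by
    have := yosidaVal_sup b (N a • A.unit) M
    rw [sup_eq_right.mpr hb, yosidaVal_smul, yosidaVal_unit, mul_one] at this
    exact sup_eq_right.mp this.symm
  have h1 := hle a ((le_abs_self a).trans (hN a))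
  have h2 := hle (-a) ((neg_le_abs a).trans (hN a))
  rw [yosidaVal_neg] at h2
  exact ⟨by linarith, h1⟩

instance : CompactSpace (Yosida A) := by
  refine ⟨isInducing_yosidaVal.isCompact_iff.mpr ?_⟩
  rw [Set.image_univ, range_yosidaVal]
  exact isCompact_charSet A

end VectorLattice

/-- The Yosida embedding `ν_A : A → C(YA)`. -/
def yosidaMap (A : WStar.{u}) : WHom A (CW (Yosida A)) where
  toFun a := (⟨yosidaVal a, continuous_yosidaVal a⟩ : C(Yosida A, ℝ))
  map_add' a b := ContinuousMap.ext fun M => yosidaVal_add a b M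
  map_smul' r a := ContinuousMap.ext fun M => yosidaVal_smul r a M
  map_sup' a b := ContinuousMap.ext fun M => yosidaVal_sup a b M
  map_inf' a b := ContinuousMap.ext fun M => yosidaVal_inf a b M
  map_unit' := ContinuousMap.ext fun M => yosidaVal_unit M

/-! ## The hull `μ(qF)` and the poset `V(H, μ(qF))` -/

/-- `(H, f)` is (up to equivalence of essential extensions of `A`) the pair
`(μ(qF)A, μ(qF)_A)`, where, with `c : qF YA → YA` the quasi-`F` cover of the Yosida space,
`μ(qF)A = C(qF YA)` and `μ(qF)_A = (g ↦ g ∘ c) ∘ ν_A`. -/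
def IsMuQFHull {A H : WStar.{u}} (f : WHom A H) : Prop :=
  ∃ (Y : Type u) (_ : TopologicalSpace Y) (_ : CompactSpace Y) (_ : T2Space Y)
    (c : C(Y, Yosida A)), IsQuasiFCover c ∧
    ∃ θ : WHom (CW Y) H, Function.Bijective θ ∧
      f = θ.comp ((CW.pullback c).comp (yosidaMap A))

/-- The `W*`-objects of which `H` is an essential extension (with the embedding). -/
structure EssSub (H : WStar.{u}) : Type (u + 1) where
  obj : WStar.{u}
  emb : WHom obj H
  essential : emb.IsEssential

/-- `(A₁, f₁) ≤ (A₂, f₂)` when there is an essential embedding `f : A₁ → A₂` with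
`f₁ = f₂ ∘ f`. -/
instance (H : WStar.{u}) : Preorder (EssSub H) where
  le P Q := ∃ f : WHom P.obj Q.obj, f.IsEssential ∧ P.emb = Q.emb.comp f
  le_refl P := ⟨WHom.id P.obj, WHom.isEssential_id P.obj, rfl⟩
  le_trans := by
    rintro P Q R ⟨f, hf, h⟩ ⟨g, hg, h'⟩
    refine ⟨g.comp f, hg.comp hf, ?_⟩
    rw [h, h']
    rfl

/-- `V(H, μ(qF))`: the `A` with `μ(qF)A = H`, each identified with the pair consisting of `A`
and its essential embedding `μ(qF)_A` into `H`. The order is the one of `EssSub H`. -/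
def VqF (H : WStar.{u}) : Set (EssSub H) := {P | IsMuQFHull P.emb}

/-- The canonical map `βℕ → αℕ` onto the one-point compactification, the identity on `ℕ`. -/
def betaToAlpha : C(StoneCech ℕ, OnePoint ℕ) where
  toFun := stoneCechExtend (g := ((↑) : ℕ → OnePoint ℕ)) OnePoint.continuous_coe
  continuous_toFun := continuous_stoneCechExtend _

end

/-! The three parts rest on deciding which functions every member of the poset must contain.

Suppose first that `K` is almost-`P`. Almost-`P` spaces are quasi-`F`, and the property descends
along covers (`IsAlmostP.of_cover`). So if `C(K)` is the hull of `A`, then `YA` is itself quasi-`F`,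
its minimal quasi-`F` cover is injective (`IsQuasiFCover.injective_of_isAlmostP`), and `A` separates
the points of `K`. Conversely, a point-separating embedding identifies `YA` with `K`, and `K` is its
own quasi-`F` cover. The members are therefore exactly the point-separating unital vector
sublattices of `C(K)`. By Stone–Weierstrass and truncation each contains the indicators of all
clopen sets, hence `F(K)` (`WHom.Separating.exists_eq_incl`). If `K` is zero-dimensional, `F(K)`
separates points and is the minimum. If `K` is connected, the functions constant near a given point
`p` form a member; a minimum would lie in all of these, so would consist of locally constant, hence
constant, functions, which cannot separate two points.

For `βℕ`, the map onto `αℕ` is the quasi-`F` cover, so `C(βℕ)` is the hull of `F(αℕ)`. Essentiality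
alone forces an embedded `A` to contain the indicator of each isolated point: restriction to the
complement of the point is not injective on `C(βℕ)`, so it kills a nonzero element of `A`, which is
a multiple of that indicator. With the unit, these indicators span `F(αℕ)`.

The order also requires the comparison maps to be essential; `WHom.isEssential_of_comp` supplies
this. -/

noncomputable section

/-! ## Elementary properties of morphisms -/

theorem eq_zero_of_abs_le_zero {A : WStar.{u}} {a : A} (h : |a| ≤ 0) : a = 0 :=
  le_antisymm ((le_abs_self a).trans h) (neg_nonpos.mp ((neg_le_abs a).trans h))

namespace WHom

variable {A B C : WStar.{u}} (f : WHom A B)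

theorem map_add (a b : A) : f (a + b) = f a + f b := f.toLinearMap.map_add a b
theorem map_sub (a b : A) : f (a - b) = f a - f b := f.toLinearMap.map_sub a b
theorem map_smul (r : ℝ) (a : A) : f (r • a) = r • f a := f.toLinearMap.map_smul r a
theorem map_zero : f 0 = 0 := f.toLinearMap.map_zero
theorem map_neg (a : A) : f (-a) = -f a := f.toLinearMap.map_neg a

theorem map_abs (a : A) : f |a| = |f a| := (f.map_sup' a (-a)).trans (by rw [map_neg]; rfl)

theorem mono {a b : A} (h : a ≤ b) : f a ≤ f b := by
  have := f.map_sup' a b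
  rw [sup_eq_right.mpr h] at this
  exact sup_eq_right.mp this.symm

theorem injective_of_forall (h : ∀ a, f a = 0 → a = 0) : Function.Injective f :=
  (injective_iff_map_eq_zero f.toLinearMap).mpr h

theorem eq_zero_of_injective {f : WHom A B} (hf : Function.Injective f) {a : A} (h : f a = 0) :
    a = 0 :=
  hf (h.trans f.map_zero.symm)

theorem ext' {f g : WHom A B} (h : ∀ a, f a = g a) : f = g := by
  cases f; cases g
  congr 1
  exact LinearMap.ext h

/-- A morphism whose range is contained in that of an injective morphism factors through it. -/
theorem exists_lift {D : WStar.{u}} (e : WHom D B) {f : WHom A B} (hf : Function.Injective f)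
    (h : ∀ d, ∃ a, f a = e d) : ∃ g : WHom D A, e = f.comp g := by
  choose g hg using h
  refine ⟨{ toFun := g, map_add' := ?_, map_smul' := ?_, map_sup' := ?_, map_inf' := ?_,
            map_unit' := ?_ }, ext' fun d => (hg d).symm⟩
  · exact fun x y => hf (by rw [map_add, hg, hg, hg, map_add])
  · exact fun r x => hf (by rw [map_smul, hg, hg, map_smul]; rfl)
  · exact fun x y => hf (by rw [f.map_sup', hg]; erw [hg, hg]; exact e.map_sup' x y)
  · exact fun x y => hf (by rw [f.map_inf', hg]; erw [hg, hg]; exact e.map_inf' x y)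
  · exact hf ((hg _).trans (e.map_unit'.trans f.map_unit'.symm))

end WHom

/-! ## Morphisms into `C(K)` and the Yosida space -/

section Dual

variable {K : Type u} [TopologicalSpace K] [CompactSpace K] {A : WStar.{u}}

/-- The function on `K` represented by the value of a morphism into `C(K)`. -/
def WHom.fn (e : WHom A (CW K)) (a : A) : C(K, ℝ) := e a

/-- The morphism separates the points of `K`. -/
def WHom.Separating (e : WHom A (CW K)) : Prop :=
  ∀ x y : K, (∀ a, e.fn a x = e.fn a y) → x = y

variable (e : WHom A (CW K))

theorem WHom.fn_add (a b : A) (x : K) : e.fn (a + b) x = e.fn a x + e.fn b x :=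
  DFunLike.congr_fun (F := C(K, ℝ)) (e.map_add a b) x

theorem WHom.fn_sub (a b : A) (x : K) : e.fn (a - b) x = e.fn a x - e.fn b x :=
  DFunLike.congr_fun (F := C(K, ℝ)) (e.map_sub a b) x

theorem WHom.fn_smul (r : ℝ) (a : A) (x : K) : e.fn (r • a) x = r * e.fn a x :=
  DFunLike.congr_fun (F := C(K, ℝ)) (e.map_smul r a) x

theorem WHom.fn_sup (a b : A) (x : K) : e.fn (a ⊔ b) x = e.fn a x ⊔ e.fn b x :=
  DFunLike.congr_fun (F := C(K, ℝ)) (e.map_sup' a b) x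

theorem WHom.fn_inf (a b : A) (x : K) : e.fn (a ⊓ b) x = e.fn a x ⊓ e.fn b x :=
  DFunLike.congr_fun (F := C(K, ℝ)) (e.map_inf' a b) x

theorem WHom.fn_unit (x : K) : e.fn A.unit x = 1 :=
  DFunLike.congr_fun (F := C(K, ℝ)) e.map_unit' x

theorem WHom.fn_zero (x : K) : e.fn 0 x = 0 :=
  DFunLike.congr_fun (F := C(K, ℝ)) e.map_zero x

/-- Evaluating `e` at `x` gives a real-valued unital lattice homomorphism, and these are precisely
the points of the Yosida space. -/
theorem WHom.exists_dual (x : K) : ∃ M : Yosida A, ∀ a, yosidaVal a M = e.fn a x := by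
  have h : (fun a => e.fn a x) ∈ charSet A :=
    ⟨fun a b => e.fn_add a b x, fun r a => e.fn_smul r a x, fun a b => e.fn_sup a b x,
      e.fn_unit x⟩
  rw [← range_yosidaVal] at h
  obtain ⟨M, hM⟩ := h
  exact ⟨M, fun a => congrFun hM a⟩

/-- The continuous map `K → YA` dual to a morphism `A → C(K)`. -/
def WHom.dual : C(K, Yosida A) where
  toFun x := (e.exists_dual x).choose
  continuous_toFun := by
    rw [isInducing_yosidaVal.continuous_iff]
    refine continuous_pi fun a => ?_
    convert (e.fn a).continuous using 1
    exact funext fun x => (e.exists_dual x).choose_spec a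

theorem WHom.yosidaVal_dual (a : A) (x : K) : yosidaVal a (e.dual x) = e.fn a x :=
  (e.exists_dual x).choose_spec a

/-! ### Consequences of Stone–Weierstrass -/

variable {e}

/-- A point-separating unital vector sublattice of `C(K)` is uniformly dense. -/
theorem WHom.Separating.exists_near (he : e.Separating) (h : C(K, ℝ)) {ε : ℝ} (hε : 0 < ε) :
    ∃ a, ∀ x, |e.fn a x - h x| < ε := by
  have hd := ContinuousMap.sublattice_closure_eq_top (Set.range e.fn) ⟨_, ⟨0, rfl⟩⟩
    (by rintro _ ⟨a, rfl⟩ _ ⟨b, rfl⟩; exact ⟨a ⊓ b, e.map_inf' a b⟩)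
    (by rintro _ ⟨a, rfl⟩ _ ⟨b, rfl⟩; exact ⟨a ⊔ b, e.map_sup' a b⟩)
    (by
      intro v x y
      by_cases hxy : x = y
      · subst hxy
        exact ⟨_, ⟨v x • A.unit, rfl⟩, by rw [fn_smul, fn_unit, mul_one],
          by rw [fn_smul, fn_unit, mul_one]⟩
      · obtain ⟨a, ha⟩ : ∃ a, e.fn a x ≠ e.fn a y := by
          by_contra! hcon
          exact hxy (he x y hcon)
        have ha' : e.fn a x - e.fn a y ≠ 0 := sub_ne_zero.mpr ha
        -- Affine interpolation in one separating element `a` takes the prescribed values at both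
        -- points.
        refine ⟨_, ⟨v y • A.unit + ((v x - v y) / (e.fn a x - e.fn a y)) •
          (a - e.fn a y • A.unit), rfl⟩, ?_, ?_⟩
        · rw [fn_add, fn_smul, fn_smul, fn_sub, fn_smul, fn_unit]
          field_simp
          ring
        · rw [fn_add, fn_smul, fn_smul, fn_sub, fn_smul, fn_unit]
          ring)
  have hmem : h ∈ closure (Set.range e.fn) := hd ▸ Set.mem_univ h
  obtain ⟨_, ⟨a, rfl⟩, ha⟩ := Metric.mem_closure_iff.mp hmem ε hε
  refine ⟨a, fun x => ?_⟩
  rw [abs_sub_comm, ← Real.dist_eq]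
  exact (ContinuousMap.dist_apply_le_dist x).trans_lt ha

/-- A point-separating unital vector sublattice of `C(K)` contains the indicators of clopen sets. -/
theorem WHom.Separating.exists_indicator (he : e.Separating) {U : Set K} (hU : IsClopen U) :
    ∃ a, ∀ x, e.fn a x = U.indicator 1 x := by
  obtain ⟨a, ha⟩ := he.exists_near ⟨U.indicator 1, hU.continuous_indicator continuous_one⟩
    (show (0 : ℝ) < 1 / 4 by norm_num)
  -- An error below `1/4` puts `a` above `3/4` on `U` and below `1/4` off it, so `2a - 1/2` exceeds
  -- `1` on `U` and is negative off it; truncation to `[0, 1]` is then exact.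
  refine ⟨(((2 : ℝ) • a - (1 / 2 : ℝ) • A.unit) ⊔ 0) ⊓ A.unit, fun x => ?_⟩
  have hx := abs_lt.mp (ha x)
  simp only [ContinuousMap.coe_mk] at hx
  rw [fn_inf, fn_sup, fn_sub, fn_smul, fn_smul, fn_unit, fn_zero]
  by_cases hxU : x ∈ U
  · rw [Set.indicator_of_mem hxU, Pi.one_apply] at hx ⊢
    rw [sup_eq_left.mpr (by linarith), inf_eq_right.mpr (by linarith)]
  · rw [Set.indicator_of_notMem hxU] at hx ⊢
    rw [sup_eq_right.mpr (by linarith), inf_eq_left.mpr (by linarith)]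

theorem yosidaMap_separating (A : WStar.{u}) : (yosidaMap A).Separating :=
  fun _ _ h => yosida_ext h

/-- The dual of an embedding is surjective. -/
theorem WHom.dual_surjective (he : Function.Injective e) : Function.Surjective e.dual := by
  intro M
  by_contra hM
  have hcl : IsClosed (Set.range e.dual) := (isCompact_range e.dual.continuous).isClosed
  obtain ⟨u, hu0, hu1, -⟩ := exists_continuous_zero_one_of_isClosed hcl
    (isClosed_singleton (x := M)) (Set.disjoint_singleton_right.mpr hM)
  obtain ⟨a, ha⟩ := (yosidaMap_separating A).exists_near u (show (0 : ℝ) < 1 / 4 by norm_num)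
  have ha' : ∀ N : Yosida A, |yosidaVal a N - u N| < 1 / 4 := ha
  -- The positive part of `a - 1/4` vanishes on the range of the dual map, so `e` kills it, while
  -- its value at `M` exceeds `1/2`.
  have hzero : e ((a - (1 / 4 : ℝ) • A.unit) ⊔ 0) = 0 := by
    refine ContinuousMap.ext (Y := ℝ) fun x => ?_
    change e.fn _ x = 0
    rw [fn_sup, fn_sub, fn_smul, fn_unit, fn_zero]
    have h1 := abs_lt.mp (ha' (e.dual x))
    rw [yosidaVal_dual, hu0 ⟨x, rfl⟩, Pi.zero_apply] at h1
    exact sup_eq_right.mpr (by linarith)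
  have h0 := eq_zero_of_injective he hzero
  have h1 := abs_lt.mp (ha' M)
  rw [hu1 rfl, Pi.one_apply] at h1
  have h2 := yosidaVal_sup (a - (1 / 4 : ℝ) • A.unit) 0 M
  rw [h0, yosidaVal_eq_zero.mpr M.1.zero_mem, sub_eq_add_neg, yosidaVal_add, yosidaVal_neg,
    yosidaVal_smul, yosidaVal_unit] at h2
  have h3 := le_sup_left.trans h2.symm.le
  linarith

theorem WHom.Separating.dual_injective (he : e.Separating) : Function.Injective e.dual :=
  fun x y h => he x y fun a => by rw [← yosidaVal_dual, h, yosidaVal_dual]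

/-- For a point-separating embedding `A → C(K)`, the space `K` is the Yosida space of `A`. -/
def WHom.Separating.homeo (he : e.Separating) (hi : Function.Injective e) : K ≃ₜ Yosida A :=
  Continuous.homeoOfEquivCompactToT2
    (f := Equiv.ofBijective e.dual ⟨he.dual_injective, e.dual_surjective hi⟩) e.dual.continuous

theorem WHom.Separating.homeo_apply (he : e.Separating) (hi : Function.Injective e) (x : K) :
    he.homeo hi x = e.dual x := rfl

/-- An embedding is essential if its range contains arbitrarily small positive elements. -/
theorem WHom.isEssential_of_forall (hi : Function.Injective e)
    (h : ∀ b : C(K, ℝ), b ≠ 0 → ∃ a, a ≠ 0 ∧ ∀ x, |e.fn a x| ≤ |b x|) : e.IsEssential := by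
  refine ⟨hi, fun C k hk => k.injective_of_forall fun b hb => ?_⟩
  by_contra hb0
  obtain ⟨a, ha0, ha⟩ := h b hb0
  have hab : |e a| ≤ |b| := ha
  have h1 := k.mono hab
  rw [k.map_abs, k.map_abs, hb, abs_zero] at h1
  have h2 : k (e a) = 0 := eq_zero_of_abs_le_zero h1
  exact ha0 (eq_zero_of_injective hk h2)

/-- Approximate `|b|` within `ε = |b x| / 4` and cut off by `ε`: the resulting positive part stays
below `|b|`, yet exceeds `|b x| / 2` at `x`. -/
theorem WHom.Separating.isEssential (he : e.Separating) (hi : Function.Injective e) :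
    e.IsEssential := by
  refine WHom.isEssential_of_forall hi fun b hb => ?_
  obtain ⟨x, hx⟩ : ∃ x, b x ≠ 0 := by
    by_contra! hcon
    exact hb (ContinuousMap.ext hcon)
  have hε : 0 < |b x| / 4 := by positivity
  obtain ⟨a, ha⟩ := he.exists_near |b| hε
  have hfn : ∀ y, e.fn ((a - (|b x| / 4) • A.unit) ⊔ 0) y = (e.fn a y - |b x| / 4) ⊔ 0 :=
    fun y => by rw [fn_sup, fn_sub, fn_smul, fn_unit, fn_zero, mul_one]
  refine ⟨(a - (|b x| / 4) • A.unit) ⊔ 0, fun h0 => ?_, fun y => ?_⟩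
  · have h1 := hfn x
    rw [h0, fn_zero] at h1
    have h2 := abs_lt.mp (ha x)
    have h3 : |b| x = |b x| := rfl
    have h4 := le_sup_left.trans h1.symm.le
    linarith
  · have h2 := abs_lt.mp (ha y)
    have h3 : |b| y = |b y| := rfl
    rw [hfn, abs_of_nonneg le_sup_right]
    exact sup_le (by linarith) (abs_nonneg _)

/-! ### Restriction to closed sets and cancellation of essential embeddings -/

/-- The restriction morphism to a closed subset. -/
def CW.restrict {Z : Set K} (hZ : IsClosed Z) :
    haveI := isCompact_iff_compactSpace.mp hZ.isCompact
    WHom (CW K) (CW Z) :=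
  haveI := isCompact_iff_compactSpace.mp hZ.isCompact
  CW.pullback ⟨Subtype.val, continuous_subtype_val⟩

theorem CW.restrict_eq_zero {Z : Set K} (hZ : IsClosed Z) {b : C(K, ℝ)} :
    haveI := isCompact_iff_compactSpace.mp hZ.isCompact
    CW.restrict hZ b = 0 ↔ ∀ z ∈ Z, b z = 0 := by
  have := isCompact_iff_compactSpace.mp hZ.isCompact
  constructor
  · intro h z hz
    exact DFunLike.congr_fun (F := C(Z, ℝ)) h ⟨z, hz⟩
  · intro h
    exact ContinuousMap.ext (Y := ℝ) fun z : Z => h z.1 z.2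

/-- An element whose image vanishes on the zero-set in `K` of the kernel of `k` lies in the
kernel of `k`. -/
theorem WHom.mem_ker_of_forall {D : WStar.{u}} {f : WHom A (CW K)} (hf : Function.Injective f)
    (k : WHom A D) {c : A} (hc : ∀ x, (∀ a, k a = 0 → f.fn a x = 0) → f.fn c x = 0) :
    k c = 0 := by
  -- The set where `|f c| ≥ ε` is compact and each of its points is moved by some kernel element, so
  -- a finite sum of multiples of absolute values of kernel elements dominates `|f c|` there.
  have key : ∀ ε : ℝ, 0 < ε → ∃ a, k a = 0 ∧ |c| ≤ a + ε • A.unit := by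
    intro ε hε
    have hcpt : IsCompact {x | ε ≤ |f.fn c x|} :=
      (isClosed_le continuous_const (f.fn c).continuous.abs).isCompact
    obtain ⟨a, ha0, hapos, ha⟩ : ∃ a, k a = 0 ∧ 0 ≤ a ∧
        ∀ x ∈ {x | ε ≤ |f.fn c x|}, |f.fn c x| < f.fn a x := by
      refine hcpt.induction_on
        (p := fun s => ∃ a, k a = 0 ∧ 0 ≤ a ∧ ∀ x ∈ s, |f.fn c x| < f.fn a x)
        ⟨0, k.map_zero, le_rfl, fun x hx => hx.elim⟩
        (fun s t hst ⟨a, h0, h1, h2⟩ => ⟨a, h0, h1, fun x hx => h2 x (hst hx)⟩) ?_ ?_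
      · rintro s t ⟨a, h0, h1, h2⟩ ⟨b, h0', h1', h2'⟩
        refine ⟨a + b, by rw [k.map_add, h0, h0', add_zero], add_nonneg h1 h1', ?_⟩
        have p1 : ∀ x, 0 ≤ f.fn a x := fun x => by
          have : f 0 ≤ f a := f.mono h1
          rw [f.map_zero] at this
          exact this x
        have p2 : ∀ x, 0 ≤ f.fn b x := fun x => by
          have : f 0 ≤ f b := f.mono h1'
          rw [f.map_zero] at this
          exact this x
        rintro x (hx | hx) <;> rw [fn_add]
        · linarith [h2 x hx, p2 x]
        · linarith [h2' x hx, p1 x]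
      · intro x hx
        have hne : f.fn c x ≠ 0 := abs_pos.mp (hε.trans_le hx)
        obtain ⟨a, ha, hax⟩ : ∃ a, k a = 0 ∧ f.fn a x ≠ 0 := by
          by_contra! hcon
          exact hne (hc x hcon)
        have habs : f.fn |a| x = |f.fn a x| :=
          DFunLike.congr_fun (F := C(K, ℝ)) (f.map_abs a) x
        -- The scaling makes `t • |a|` exceed `|f c|` by `1` at `x`, hence strictly on a
        -- neighbourhood.
        set t : ℝ := (|f.fn c x| + 1) / |f.fn a x| with ht
        have hfx : f.fn (t • |a|) x = |f.fn c x| + 1 := by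
          rw [fn_smul, habs, ht]
          have := abs_pos.mpr hax
          field_simp
        have hopen : IsOpen {y | |f.fn c y| < f.fn (t • |a|) y} :=
          isOpen_lt (f.fn c).continuous.abs (f.fn _).continuous
        refine ⟨_, mem_nhdsWithin_of_mem_nhds (hopen.mem_nhds
          (show |f.fn c x| < f.fn (t • |a|) x by rw [hfx]; linarith)), t • |a|, ?_, ?_,
          fun y hy => hy⟩
        · rw [k.map_smul, k.map_abs, ha, abs_zero, smul_zero]
        · exact smul_nonneg (by positivity) (abs_nonneg a)
    refine ⟨a, ha0, ?_⟩
    have hle : f |c| ≤ f (a + ε • A.unit) := by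
      intro x
      change f.fn |c| x ≤ f.fn _ x
      have habs : f.fn |c| x = |f.fn c x| :=
        DFunLike.congr_fun (F := C(K, ℝ)) (f.map_abs c) x
      have h0 : 0 ≤ f.fn a x := by
        have : f 0 ≤ f a := f.mono hapos
        rw [f.map_zero] at this
        exact this x
      rw [habs, fn_add, fn_smul, fn_unit, mul_one]
      by_cases hx : ε ≤ |f.fn c x|
      · linarith [ha x hx]
      · linarith [not_le.mp hx]
    -- An injective lattice homomorphism reflects the order, so the pointwise bound on `K` becomes a
    -- bound in `A`.
    have h1 := f.map_sup' |c| (a + ε • A.unit)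
    rw [sup_eq_right.mpr hle] at h1
    exact sup_eq_right.mp (hf h1)
  -- Now `k |c|` lies below every positive multiple of the unit, and `D` is Archimedean. Taking `ε =
  -- 1 / (n + 1)` covers `n = 0` as well.
  refine eq_zero_of_abs_le_zero (D.archimedean _ D.unit fun n => ?_)
  obtain ⟨a, ha, hle⟩ := key (1 / (n + 1)) (by positivity)
  have h1 := k.mono hle
  rw [k.map_abs, k.map_add, ha, zero_add, k.map_smul, k.map_unit'] at h1
  refine (nsmul_le_nsmul_right h1 n).trans ?_
  rw [← Nat.cast_smul_eq_nsmul ℝ, smul_smul]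
  conv_rhs => rw [← one_smul ℝ D.unit]
  refine smul_le_smul_of_nonneg_right ?_ D.unit_nonneg
  rw [mul_one_div, div_le_one (by positivity)]
  linarith

/-- If `f ∘ g` is essential and `f` is injective, then `g` is essential. -/
theorem WHom.isEssential_of_comp {B : WStar.{u}} {f : WHom A (CW K)} {g : WHom B A}
    (hf : Function.Injective f) (h : (f.comp g).IsEssential) : g.IsEssential := by
  refine ⟨fun x y hxy => h.1 (congrArg f hxy), fun D k hk => k.injective_of_forall fun a ha => ?_⟩
  -- Essentiality of `f ∘ g` only tests morphisms on `C(K)`, so `k` is replaced by restriction to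
  -- the common zero-set of its kernel. An element of `A` vanishing on that set is killed by `k`;
  -- hence the restriction is injective along `f ∘ g`, so on all of `C(K)`, and it kills the image
  -- of `ker k`.
  have hZ : IsClosed {x : K | ∀ a, k a = 0 → f.fn a x = 0} := by
    simp only [Set.ofPred_forall]
    exact isClosed_iInter fun a => isClosed_iInter fun _ =>
      isClosed_eq (f.fn a).continuous continuous_const
  have := isCompact_iff_compactSpace.mp hZ.isCompact
  have hinj : Function.Injective (CW.restrict hZ) := by
    refine h.2 _ _ (injective_of_forall _ fun b hb => ?_)
    have hb' := (CW.restrict_eq_zero hZ).mp hb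
    exact eq_zero_of_injective hk (mem_ker_of_forall hf k hb')
  have h0 : CW.restrict hZ (f a) = 0 := (CW.restrict_eq_zero hZ).mpr fun x hx => hx a ha
  exact eq_zero_of_injective hf (eq_zero_of_injective hinj h0)

end Dual

end

noncomputable section

/-! ## Covers -/

section Covers

variable {X Y Z : Type u} [TopologicalSpace X] [TopologicalSpace Y] [TopologicalSpace Z]

theorem isCover_id (X : Type u) [TopologicalSpace X] : IsCover (id : X → X) where
  continuous := continuous_id
  surjective := Function.surjective_id
  isClosedMap := IsClosedMap.id
  isCompact_fiber _ := isCompact_singleton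
  irreducible F _ hF := by rwa [Set.image_id]

theorem IsCover.homeo_comp {f : Y → X} (hf : IsCover f) (σ : X ≃ₜ Z) : IsCover (σ ∘ f) where
  continuous := σ.continuous.comp hf.continuous
  surjective := σ.surjective.comp hf.surjective
  isClosedMap := σ.isClosedMap.comp hf.isClosedMap
  isCompact_fiber z := by
    have : (σ ∘ f) ⁻¹' {z} = f ⁻¹' {σ.symm z} := by
      ext y
      simp [σ.eq_symm_apply]
    rw [this]
    exact hf.isCompact_fiber _
  irreducible F hF hne h := by
    refine hf.irreducible F hF hne ?_
    rw [Set.image_comp] at h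
    rw [← σ.injective.preimage_image (f '' F), h, Set.preimage_univ]

theorem IsQuasiFCover.homeo_comp {f : Y → X} (hf : IsQuasiFCover f) (σ : X ≃ₜ Z) :
    IsQuasiFCover (σ ∘ f) where
  isCover := hf.isCover.homeo_comp σ
  isQuasiF := hf.isQuasiF
  minimum W _ _ _ g hg hW := by
    obtain ⟨k, hk, h⟩ := hf.minimum W _ (hg.homeo_comp σ.symm) hW
    refine ⟨k, hk, ?_⟩
    rw [Function.comp_assoc, ← h]
    ext w
    simp

theorem isQuasiFCover_id (hX : IsQuasiF X) : IsQuasiFCover (id : X → X) where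
  isCover := isCover_id X
  isQuasiF := hX
  minimum _ _ _ _ f hf _ := ⟨f, hf.continuous, rfl⟩

/-- The closure of the preimage has closed image containing `S`, hence maps onto `X`; irreducibility
rules out that it is proper. -/
theorem IsCover.dense_preimage {f : Y → X} (hf : IsCover f) {S : Set X} (hS : Dense S) :
    Dense (f ⁻¹' S) := by
  rw [dense_iff_closure_eq] at *
  by_contra hne
  refine hf.irreducible _ isClosed_closure hne (Set.univ_subset_iff.mp ?_)
  rw [← hS]
  refine closure_minimal (fun x hx => ?_) (hf.isClosedMap _ isClosed_closure)
  obtain ⟨y, rfl⟩ := hf.surjective x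
  exact ⟨y, subset_closure hx, rfl⟩

theorem IsCozero.isOpen {S : Set X} (hS : IsCozero S) : IsOpen S := by
  obtain ⟨f, rfl⟩ := hS
  exact isOpen_ne.preimage f.continuous

theorem IsCozero.preimage {S : Set X} (hS : IsCozero S) {f : Y → X} (hf : Continuous f) :
    IsCozero (f ⁻¹' S) := by
  obtain ⟨g, rfl⟩ := hS
  exact ⟨g.comp ⟨f, hf⟩, rfl⟩

/-- The only dense cozero-set is the whole space, so there is nothing to extend. -/
theorem IsAlmostP.isQuasiF (hX : IsAlmostP X) : IsQuasiF X := by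
  intro S hS hd g
  obtain rfl := hX S hS hd
  exact ⟨g.toContinuousMap.comp ⟨fun x => ⟨x, trivial⟩, by fun_prop⟩, fun s => rfl⟩

/-- Dense cozero-sets pull back to dense cozero-sets along a cover, and surjectivity carries the
equality with the whole space back down. -/
theorem IsAlmostP.of_cover (hY : IsAlmostP Y) {f : Y → X} (hf : IsCover f) : IsAlmostP X := by
  intro S hS hd
  have h := hY _ (hS.preimage hf.continuous) (hf.dense_preimage hd)
  exact Set.preimage_injective.mpr hf.surjective (h.trans Set.preimage_univ.symm)

theorem isCover_homeo (σ : X ≃ₜ Z) : IsCover σ := (isCover_id X).homeo_comp σ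

/-- A quasi-`F` cover with almost-`P` domain is injective. -/
theorem IsQuasiFCover.injective_of_isAlmostP [CompactSpace X] [T2Space X] [CompactSpace Y]
    [T2Space Y] {c : Y → X} (hc : IsQuasiFCover c) (hY : IsAlmostP Y) : Function.Injective c := by
  -- Since `X` is quasi-`F`, its identity competes with `c`, and minimality yields a section `g`.
  -- Its closed range maps onto `X`, so by irreducibility `g` is onto, which makes `c` injective.
  obtain ⟨g, hg, h⟩ := hc.minimum X id (isCover_id X) (hY.of_cover hc.isCover).isQuasiF
  have hcg : ∀ x, c (g x) = x := fun x => (congrFun h x).symm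
  have hsurj : Set.range g = Set.univ := by
    by_contra hne
    refine hc.isCover.irreducible _ (isCompact_range hg).isClosed hne ?_
    exact Set.eq_univ_of_forall fun x => ⟨g x, ⟨x, rfl⟩, hcg x⟩
  intro y y' hyy
  obtain ⟨x, rfl⟩ := hsurj.symm ▸ Set.mem_univ y
  obtain ⟨x', rfl⟩ := hsurj.symm ▸ Set.mem_univ y'
  rw [hcg, hcg] at hyy
  rw [hyy]

/-- Continuous maps from a dense `C*`-embedded subspace into a compact Hausdorff space extend. -/
theorem IsCStarEmbedded.exists_extend {S : Set Z} (hS : IsCStarEmbedded S) (hd : Dense S)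
    [CompactSpace X] [T2Space X] {h : S → X} (hh : Continuous h) :
    ∃ g : Z → X, Continuous g ∧ ∀ s : S, g s = h s := by
  choose G hG using fun φ : C(X, ℝ) =>
    hS ((BoundedContinuousFunction.mkOfCompact φ).compContinuous ⟨h, hh⟩)
  have hG' : ∀ (φ : C(X, ℝ)) (s : S), G φ s = φ (h s) := hG
  -- Embed `X` in a power of `ℝ` by evaluation and extend coordinatewise; density of `S` keeps the
  -- extension inside the closed image of `X`.
  let ev : X → C(X, ℝ) → ℝ := fun x φ => φ x
  have hev : Continuous ev := continuous_pi fun φ => φ.continuous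
  have hinj : Function.Injective ev := by
    intro x y hxy
    by_contra hne
    obtain ⟨u, hu0, hu1, -⟩ := exists_continuous_zero_one_of_isClosed
      (isClosed_singleton (x := x)) (isClosed_singleton (x := y)) (by simpa using hne)
    have h1 : u x = u y := congrFun hxy u
    rw [hu0 rfl, hu1 rfl] at h1
    exact zero_ne_one h1
  have hemb : IsClosedEmbedding ev := hev.isClosedEmbedding hinj
  let Φ : Z → C(X, ℝ) → ℝ := fun z φ => G φ z
  have hΦ : Continuous Φ := continuous_pi fun φ => (G φ).continuous
  have hmem : ∀ z, Φ z ∈ Set.range ev := by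
    have hcl : IsClosed (Φ ⁻¹' Set.range ev) := hemb.isClosed_range.preimage hΦ
    have hsub : S ⊆ Φ ⁻¹' Set.range ev := fun s hs =>
      ⟨h ⟨s, hs⟩, funext fun φ => (hG' φ ⟨s, hs⟩).symm⟩
    intro z
    exact closure_minimal hsub hcl (hd z)
  choose g hg using hmem
  refine ⟨g, hemb.isInducing.continuous_iff.mpr ?_, fun s => hinj ?_⟩
  · rwa [show ev ∘ g = Φ from funext hg]
  · rw [hg]
    exact funext fun φ => hG' φ s

end Covers

/-! ## Hulls -/

section Hulls

variable {K : Type u} [TopologicalSpace K] [CompactSpace K] {A : WStar.{u}}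

theorem id_separating (K : Type u) [TopologicalSpace K] [CompactSpace K] [T2Space K] :
    (WHom.id (CW K)).Separating := by
  intro x y hxy
  by_contra hne
  obtain ⟨u, hu0, hu1, -⟩ := exists_continuous_zero_one_of_isClosed
    (isClosed_singleton (x := x)) (isClosed_singleton (x := y)) (by simpa using hne)
  have h1 : u x = u y := hxy u
  rw [hu0 rfl, hu1 rfl] at h1
  exact zero_ne_one h1

/-- Isomorphisms `C(Y) → C(K)` come from homeomorphisms. -/
theorem WHom.exists_homeo [T2Space K] {Y : Type u} [TopologicalSpace Y] [CompactSpace Y] [T2Space Y]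
    (θ : WHom (CW Y) (CW K)) (hθ : Function.Bijective θ) :
    ∃ σ : K ≃ₜ Y, ∀ (a : CW Y) (x : K), θ.fn a x = (WHom.id (CW Y)).fn a (σ x) := by
  let η := (id_separating Y).homeo Function.injective_id
  have hsep : θ.Separating := by
    intro x y h
    refine id_separating K x y fun b => ?_
    obtain ⟨a, rfl⟩ := hθ.2 b
    exact h a
  refine ⟨(hsep.homeo hθ.1).trans η.symm, fun a x => ?_⟩
  change θ.fn a x = (WHom.id (CW Y)).fn a (η.symm (θ.dual x))
  rw [← yosidaVal_dual, ← yosidaVal_dual, ← Separating.homeo_apply (id_separating Y)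
    Function.injective_id, Homeomorph.apply_symm_apply]

/-- If `π` is the quasi-`F` cover of the Yosida space `X` of `A ⊆ C(X)`, then `C(Y)` is the
hull of `A`. -/
theorem WHom.Separating.isMuQFHull_pullback {Y : Type u} [TopologicalSpace Y] [CompactSpace Y]
    [T2Space Y] {e : WHom A (CW K)} (he : e.Separating) (hi : Function.Injective e) (π : C(Y, K))
    (hπ : IsQuasiFCover π) : IsMuQFHull ((CW.pullback π).comp e) := by
  refine ⟨Y, inferInstance, inferInstance, inferInstance, e.dual.comp π,
    hπ.homeo_comp (he.homeo hi), WHom.id _, Function.bijective_id, ext' fun a => ?_⟩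
  exact ContinuousMap.ext (Y := ℝ) fun y => (e.yosidaVal_dual a (π y)).symm

theorem WHom.Separating.isMuQFHull [T2Space K] {e : WHom A (CW K)} (he : e.Separating)
    (hi : Function.Injective e) (hK : IsQuasiF K) : IsMuQFHull e :=
  he.isMuQFHull_pullback hi (ContinuousMap.id K) (isQuasiFCover_id hK)

/-- If `C(K)` is the hull of `A` and `K` is almost-`P`, then `A` separates the points of `K`. -/
theorem IsMuQFHull.separating [T2Space K] {f : WHom A (CW K)} (hf : IsMuQFHull f) (hK : IsAlmostP K) :
    f.Separating := by
  obtain ⟨Y, _, _, _, c, hc, θ, hθ, rfl⟩ := hf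
  obtain ⟨σ, hσ⟩ := θ.exists_homeo hθ
  -- `Y` is homeomorphic to `K`, hence almost-`P`. With `c` injective, the elements of `A` separate
  -- points of `Y` because they separate points of `YA`.
  have hinj := hc.injective_of_isAlmostP (hK.of_cover (isCover_homeo σ))
  intro x y h
  refine σ.injective (hinj (yosida_ext fun a => ?_))
  exact (hσ _ x).symm.trans ((h a).trans (hσ _ y))

end Hulls

/-! ## Sublattices of `C(K)` -/

section FiniteRange

variable {K : Type u} [TopologicalSpace K] [CompactSpace K]

theorem FW.incl_injective : Function.Injective (FW.incl K) := Subtype.val_injective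

/-- The indicator of a clopen set. -/
def FW.indicator {U : Set K} (hU : IsClopen U) : FW K :=
  (⟨⟨U.indicator 1, hU.continuous_indicator continuous_one⟩, by
    refine (Set.toFinite {(0 : ℝ), 1}).subset ?_
    rintro _ ⟨x, rfl⟩
    by_cases hx : x ∈ U <;> simp [hx]⟩ : finRangeSubmodule K)

theorem FW.incl_indicator {U : Set K} (hU : IsClopen U) (x : K) :
    (FW.incl K).fn (FW.indicator hU) x = U.indicator 1 x := rfl

/-- The clopen set may contain either point, so that for `αℕ` singletons of integers suffice, even
when one of the points is `∞`. -/
theorem FW.incl_separating (h : ∀ x y : K, x ≠ y → ∃ U : Set K, IsClopen U ∧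
    (x ∈ U ∧ y ∉ U ∨ y ∈ U ∧ x ∉ U)) : (FW.incl K).Separating := by
  intro x y hxy
  by_contra hne
  obtain ⟨U, hU, hmem⟩ := h x y hne
  have h1 := hxy (FW.indicator hU)
  rw [FW.incl_indicator, FW.incl_indicator] at h1
  rcases hmem with ⟨hx, hy⟩ | ⟨hx, hy⟩ <;> simp [hx, hy] at h1

/-- The complement of a fibre is the preimage of a finite, hence closed, set of values. -/
theorem FW.isClopen_preimage (d : FW K) (r : ℝ) : IsClopen ((FW.incl K).fn d ⁻¹' {r}) := by
  have hfin : (Set.range ((FW.incl K).fn d)).Finite := d.2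
  refine ⟨isClosed_singleton.preimage ((FW.incl K).fn d).continuous, ?_⟩
  have : ((FW.incl K).fn d ⁻¹' {r}) =
      ((FW.incl K).fn d ⁻¹' (Set.range ((FW.incl K).fn d) \ {r}))ᶜ := by
    ext x
    simp
  rw [this]
  exact ((hfin.subset Set.sdiff_subset).isClosed.preimage
    ((FW.incl K).fn d).continuous).isOpen_compl

/-- A point-separating unital vector sublattice of `C(K)` contains `F(K)`. -/
theorem WHom.Separating.exists_eq_incl {A : WStar.{u}} {f : WHom A (CW K)} (hf : f.Separating)
    (d : FW K) : ∃ a, f a = FW.incl K d := by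
  have hfin : (Set.range ((FW.incl K).fn d)).Finite := d.2
  choose a ha using fun r : ℝ => hf.exists_indicator (FW.isClopen_preimage d r)
  -- A function of finite range is the sum of its values times the indicators of its clopen fibres.
  refine ⟨∑ r ∈ hfin.toFinset, r • a r, ContinuousMap.ext (Y := ℝ) fun x => ?_⟩
  change f.fn _ x = (FW.incl K).fn d x
  have hsum : f.fn (∑ r ∈ hfin.toFinset, r • a r) x = ∑ r ∈ hfin.toFinset, f.fn (r • a r) x :=
    map_sum (AddMonoidHom.mk' (fun b => f.fn b x) fun b b' => f.fn_add b b' x) _ _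
  rw [hsum, Finset.sum_eq_single ((FW.incl K).fn d x)]
  · rw [fn_smul, ha, Set.indicator_of_mem (by simp), Pi.one_apply, mul_one]
  · intro r _ hr
    rw [fn_smul, ha, Set.indicator_of_notMem (by simpa using hr.symm), mul_zero]
  · intro h
    simp at h

end FiniteRange

/-! ### Comparison of subobjects and the zero-dimensional case -/

/-- A minimum criterion for the poset of essential subobjects. -/
theorem EssSub.mk_le {K : Type u} [TopologicalSpace K] [CompactSpace K] {D : WStar.{u}}
    {e : WHom D (CW K)} (he : e.IsEssential) (P : EssSub (CW K))
    (h : ∀ d, ∃ a, P.emb a = e d) : (⟨D, e, he⟩ : EssSub (CW K)) ≤ P := by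
  obtain ⟨g, hg⟩ := WHom.exists_lift e P.essential.1 h
  refine ⟨g, WHom.isEssential_of_comp P.essential.1 ?_, hg⟩
  rwa [← hg]

theorem isLeast_finRange_of_zeroDim (K : Type u) [TopologicalSpace K] [CompactSpace K]
    [T2Space K] (hK : IsAlmostP K) (hZ : IsZeroDim K) :
    ∃ h : (FW.incl K).IsEssential, IsLeast (VqF (CW K)) ⟨FW K, FW.incl K, h⟩ := by
  have hsep : (FW.incl K).Separating := FW.incl_separating fun x y hne => by
    obtain ⟨U, hU, hx, hy⟩ := hZ.exists_subset_of_mem_open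
      (show x ∈ ({y}ᶜ : Set K) from hne) isOpen_compl_singleton
    exact ⟨U, hU, Or.inl ⟨hx, fun h => hy h rfl⟩⟩
  refine ⟨hsep.isEssential FW.incl_injective, hsep.isMuQFHull FW.incl_injective hK.isQuasiF, ?_⟩
  intro P hP
  exact EssSub.mk_le _ P fun d => (IsMuQFHull.separating hP hK).exists_eq_incl d

/-! ## Functions that are locally constant at a point -/

section LocallyConstantAt

variable {K : Type u} [TopologicalSpace K]

/-- The continuous functions that are constant on a neighbourhood of `p`. -/
def constNearSubmodule (p : K) : Submodule ℝ C(K, ℝ) where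
  carrier := {f | ∀ᶠ x in 𝓝 p, f x = f p}
  add_mem' {f g} hf hg := by
    filter_upwards [hf, hg] with x h1 h2
    rw [ContinuousMap.add_apply, ContinuousMap.add_apply, h1, h2]
  zero_mem' := Filter.Eventually.of_forall fun _ => rfl
  smul_mem' r f hf := by
    filter_upwards [hf] with x h
    rw [ContinuousMap.smul_apply, ContinuousMap.smul_apply, h]

theorem constNear_sup {p : K} {f g : C(K, ℝ)} (hf : f ∈ constNearSubmodule p)
    (hg : g ∈ constNearSubmodule p) : f ⊔ g ∈ constNearSubmodule p := by
  filter_upwards [hf, hg] with x h1 h2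
  rw [ContinuousMap.sup_apply, ContinuousMap.sup_apply, h1, h2]

theorem constNear_inf {p : K} {f g : C(K, ℝ)} (hf : f ∈ constNearSubmodule p)
    (hg : g ∈ constNearSubmodule p) : f ⊓ g ∈ constNearSubmodule p := by
  filter_upwards [hf, hg] with x h1 h2
  rw [ContinuousMap.inf_apply, ContinuousMap.inf_apply, h1, h2]

variable [CompactSpace K]

/-- The object of the continuous functions that are constant on a neighbourhood of `p`. -/
def ConstNear (p : K) : WStar.{u} :=
  letI : Lattice (constNearSubmodule p) :=
    Subtype.lattice (fun _ _ hf hg => constNear_sup hf hg) (fun _ _ hf hg => constNear_inf hf hg)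
  { carrier := constNearSubmodule p
    isOrderedAddMonoid := ⟨fun _ _ h c => add_le_add_left (α := C(K, ℝ)) h c,
      fun _ _ h c => add_le_add_right (α := C(K, ℝ)) h c⟩
    isOrderedModule :=
      { smul_le_smul_of_nonneg_left := fun _r hr _f _g h x => mul_le_mul_of_nonneg_left (h x) hr
        smul_le_smul_of_nonneg_right := fun _f hf _r _s h x =>
          mul_le_mul_of_nonneg_right h (hf x) }
    unit := ⟨1, Filter.Eventually.of_forall fun _ => rfl⟩
    unit_nonneg := fun _ => zero_le_one
    exists_le_nsmul_unit := fun a => exists_le_nsmul_one a.1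
    archimedean := fun a b h => cont_archimedean a.1 b.1 h }

/-- The inclusion into `C(K)`. -/
def ConstNear.incl (p : K) : WHom (ConstNear p) (CW K) where
  toFun := (constNearSubmodule p).subtype
  map_add' _ _ := rfl
  map_smul' _ _ := rfl
  map_sup' _ _ := rfl
  map_inf' _ _ := rfl
  map_unit' := rfl

theorem ConstNear.incl_injective (p : K) : Function.Injective (ConstNear.incl p) :=
  Subtype.val_injective

theorem ConstNear.eventually_eq {p : K} (d : ConstNear p) :
    ∀ᶠ x in 𝓝 p, (ConstNear.incl p).fn d x = (ConstNear.incl p).fn d p := d.2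

/-- A Urysohn function supported away from a neighbourhood of `p` is constant near `p`. The point
where it equals `1` must differ from `p`; the other point may be `p` itself. -/
theorem ConstNear.exists_separating [T2Space K] {p x y : K} (hne : x ≠ y) (hy : y ≠ p) :
    ∃ d : ConstNear p, (ConstNear.incl p).fn d x ≠ (ConstNear.incl p).fn d y := by
  obtain ⟨V, W, hV, hW, hyV, hpW, hVW⟩ := t2_separation hy
  obtain ⟨u, hu0, hu1, -⟩ := exists_continuous_zero_one_of_isClosed
    (s := Vᶜ ∪ {x}) (t := {y}) (hV.isClosed_compl.union isClosed_singleton)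
    isClosed_singleton (by simp [hyV, hne.symm])
  have hconst : u ∈ constNearSubmodule p := by
    have hz : ∀ q ∈ W, u q = 0 := fun q hq => hu0 (Or.inl fun h => hVW.le_bot ⟨h, hq⟩)
    filter_upwards [hW.mem_nhds hpW] with q hq
    rw [hz q hq, hz p hpW]
  refine ⟨(⟨u, hconst⟩ : constNearSubmodule p), ?_⟩
  change u x ≠ u y
  rw [hu0 (Or.inr rfl), hu1 rfl]
  exact zero_ne_one

theorem ConstNear.incl_separating [T2Space K] (p : K) : (ConstNear.incl p).Separating := by
  intro x y hxy
  by_contra hne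
  by_cases hy : y = p
  · obtain ⟨d, hd⟩ := ConstNear.exists_separating (p := p) (Ne.symm hne) (hy ▸ hne)
    exact hd (hxy d).symm
  · obtain ⟨d, hd⟩ := ConstNear.exists_separating hne hy
    exact hd (hxy d)

end LocallyConstantAt

theorem not_exists_isLeast_of_connected (K : Type u) [TopologicalSpace K] [CompactSpace K]
    [T2Space K] [ConnectedSpace K] [Nontrivial K] (hK : IsAlmostP K) :
    ¬ ∃ M, IsLeast (VqF (CW K)) M := by
  rintro ⟨M, hM, hmin⟩
  have hsep : M.emb.Separating := IsMuQFHull.separating hM hK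
  obtain ⟨x, y, hne⟩ := exists_pair_ne K
  refine hne (hsep x y fun a => ?_)
  -- For each `p`, minimality factors `M` through the functions constant near `p`; letting `p` vary
  -- makes every element of `M` locally constant.
  have hloc : IsLocallyConstant (M.emb.fn a) := by
    refine (IsLocallyConstant.iff_eventually_eq _).mpr fun p => ?_
    have hs := ConstNear.incl_separating p
    obtain ⟨g, -, hg⟩ := hmin (a := ⟨ConstNear p, ConstNear.incl p,
      hs.isEssential (ConstNear.incl_injective p)⟩)
        (hs.isMuQFHull (ConstNear.incl_injective p) hK.isQuasiF)
    have h := ConstNear.eventually_eq (g a)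
    have h' : M.emb.fn a = (ConstNear.incl p).fn (g a) := by
      rw [hg]
      rfl
    rwa [h']
  exact hloc.apply_eq_of_isPreconnected isPreconnected_univ trivial trivial

end

noncomputable section

/-! ## The quasi-`F` cover of the one-point compactification of the integers -/

section BetaNat

theorem betaToAlpha_unit (n : ℕ) : betaToAlpha (stoneCechUnit n) = (n : OnePoint ℕ) :=
  stoneCechExtend_stoneCechUnit OnePoint.continuous_coe n

theorem OnePoint.isClopen_singleton_coe (n : ℕ) :
    IsClopen ({(n : OnePoint ℕ)} : Set (OnePoint ℕ)) := by
  refine ⟨isClosed_singleton, ?_⟩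
  rw [← Set.image_singleton]
  exact OnePoint.isOpen_image_coe.mpr (isOpen_discrete _)

theorem isOpen_betaToAlpha_fiber (n : ℕ) : IsOpen (betaToAlpha ⁻¹' {(n : OnePoint ℕ)}) :=
  (OnePoint.isClopen_singleton_coe n).isOpen.preimage betaToAlpha.continuous

theorem exists_unit_mem {W : Set (StoneCech ℕ)} (hW : IsOpen W) (hne : W.Nonempty) :
    ∃ m : ℕ, stoneCechUnit m ∈ W := by
  obtain ⟨_, hx, m, rfl⟩ := denseRange_stoneCechUnit.inter_open_nonempty W hW hne
  exact ⟨m, hx⟩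

/-- The fibre over `n` is open. Removing the point `n` leaves an open set containing no integer,
hence empty by density: integers are isolated in `βℕ`. -/
theorem eq_unit_of_betaToAlpha_eq {x : StoneCech ℕ} {n : ℕ} (h : betaToAlpha x = n) :
    x = stoneCechUnit n := by
  by_contra hne
  obtain ⟨m, hm, hm'⟩ := exists_unit_mem
    ((isOpen_betaToAlpha_fiber n).inter isOpen_compl_singleton) ⟨x, h, hne⟩
  rw [Set.mem_preimage, betaToAlpha_unit, Set.mem_singleton_iff, OnePoint.coe_eq_coe] at hm
  exact hm' (by rw [hm]; rfl)

theorem unit_mem_of_dense {S : Set (StoneCech ℕ)} (hd : Dense S) (n : ℕ) :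
    stoneCechUnit n ∈ S := by
  obtain ⟨x, hx, hxS⟩ := hd.inter_open_nonempty _ (isOpen_betaToAlpha_fiber n)
    ⟨stoneCechUnit n, betaToAlpha_unit n⟩
  rwa [← eq_unit_of_betaToAlpha_eq hx]

/-- A dense set contains every isolated point, hence `ℕ`. The restriction of `g` to `ℕ` extends over
`βℕ`, and the extension agrees with `g` on `S` because `ℕ` is dense in the open set `S`. -/
theorem isQuasiF_stoneCech_nat : IsQuasiF (StoneCech ℕ) := by
  intro S hS hd g
  have hb : ∀ s, g s ∈ Set.Icc (-‖g‖) ‖g‖ := fun s =>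
    abs_le.mp ((Real.norm_eq_abs _).symm.le.trans (g.norm_coe_le_norm s))
  -- The extension property needs a compact target, so boundedness of `g` is used to land in a
  -- closed interval.
  let g₀ : ℕ → Set.Icc (-‖g‖) ‖g‖ := fun n => ⟨g ⟨_, unit_mem_of_dense hd n⟩, hb _⟩
  have hg₀ : Continuous g₀ := continuous_of_discreteTopology
  refine ⟨⟨fun x => (stoneCechExtend hg₀ x : Set.Icc (-‖g‖) ‖g‖),
    continuous_subtype_val.comp (continuous_stoneCechExtend hg₀)⟩, ?_⟩
  have hdS : Dense {s : S | ∃ n : ℕ, s.1 = stoneCechUnit n} := by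
    rw [dense_iff_inter_open]
    intro U hU ⟨s, hs⟩
    have hUo : IsOpen (Subtype.val '' U : Set (StoneCech ℕ)) :=
      hS.isOpen.isOpenMap_subtype_val U hU
    obtain ⟨m, t, ht, htm⟩ := exists_unit_mem hUo ⟨s.1, s, hs, rfl⟩
    exact ⟨t, ht, m, htm⟩
  have heq : (fun s : S => ((stoneCechExtend hg₀ s.1 : Set.Icc (-‖g‖) ‖g‖) : ℝ)) = g := by
    refine Continuous.ext_on hdS ?_ g.continuous ?_
    · exact continuous_subtype_val.comp
        ((continuous_stoneCechExtend hg₀).comp continuous_subtype_val)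
    · rintro ⟨_, hs⟩ ⟨n, rfl⟩
      change ((stoneCechExtend hg₀ (stoneCechUnit n) : Set.Icc (-‖g‖) ‖g‖) : ℝ) = _
      rw [stoneCechExtend_stoneCechUnit]
  exact fun s => congrFun heq s

theorem betaToAlpha_surjective : Function.Surjective betaToAlpha := by
  have hcl : IsClosed (Set.range betaToAlpha) :=
    (isCompact_range betaToAlpha.continuous).isClosed
  have hsub : Set.range ((↑) : ℕ → OnePoint ℕ) ⊆ Set.range betaToAlpha := by
    rintro _ ⟨n, rfl⟩
    exact ⟨stoneCechUnit n, betaToAlpha_unit n⟩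
  exact fun x => closure_minimal hsub hcl (OnePoint.denseRange_coe x)

theorem isCover_betaToAlpha : IsCover betaToAlpha where
  continuous := betaToAlpha.continuous
  surjective := betaToAlpha_surjective
  isClosedMap := betaToAlpha.continuous.isClosedMap
  isCompact_fiber x := (isClosed_singleton.preimage betaToAlpha.continuous).isCompact
  irreducible F hF hne h := by
    -- Each integer has a single preimage, so a closed set mapping onto `αℕ` contains the dense set
    -- `ℕ`.
    refine hne (Set.univ_subset_iff.mp ?_)
    rw [← denseRange_stoneCechUnit.closure_range]
    refine closure_minimal ?_ hF
    rintro _ ⟨n, rfl⟩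
    obtain ⟨x, hx, hxn⟩ : (n : OnePoint ℕ) ∈ betaToAlpha '' F := h ▸ Set.mem_univ _
    rwa [← eq_unit_of_betaToAlpha_eq hxn]

theorem isCozero_range_coe : IsCozero (Set.range ((↑) : ℕ → OnePoint ℕ)) := by
  let φ : OnePoint ℕ → ℝ := fun x => x.elim 0 fun n => 1 / ((n : ℝ) + 1)
  have hφ : Continuous φ :=
    (OnePoint.continuous_iff_from_nat φ).mpr tendsto_one_div_add_atTop_nhds_zero_nat
  refine ⟨⟨φ, hφ⟩, Set.ext fun x => ?_⟩
  induction x using OnePoint.rec with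
  | infty => simp [φ]
  | coe n =>
    have : (n : ℝ) + 1 ≠ 0 := by positivity
    simpa [φ] using this

/-- For a quasi-`F` cover `Z`, the preimage of `ℕ` is a dense cozero-set, so its map to `ℕ ⊆ βℕ`
extends over `Z`. The triangle commutes on that dense set, hence everywhere. -/
theorem isQuasiFCover_betaToAlpha : IsQuasiFCover betaToAlpha where
  isCover := isCover_betaToAlpha
  isQuasiF := isQuasiF_stoneCech_nat
  minimum Z _ _ _ f hf hZ := by
    have hd : Dense (f ⁻¹' Set.range ((↑) : ℕ → OnePoint ℕ)) :=
      hf.dense_preimage OnePoint.denseRange_coe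
    have hS := hZ _ (isCozero_range_coe.preimage hf.continuous) hd
    let ι : Set.range ((↑) : ℕ → OnePoint ℕ) ≃ₜ ℕ :=
      (OnePoint.isOpenEmbedding_coe (X := ℕ)).isEmbedding.toHomeomorph.symm
    let r : f ⁻¹' Set.range ((↑) : ℕ → OnePoint ℕ) → Set.range ((↑) : ℕ → OnePoint ℕ) :=
      fun s => ⟨f s.1, s.2⟩
    have hr : Continuous r := (hf.continuous.comp continuous_subtype_val).subtype_mk _
    obtain ⟨g, hg, hgs⟩ := hS.exists_extend hd
      (continuous_stoneCechUnit.comp (ι.continuous.comp hr))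
    refine ⟨g, hg, Continuous.ext_on hd hf.continuous (betaToAlpha.continuous.comp hg) ?_⟩
    intro s hs
    have h1 := hgs ⟨s, hs⟩
    change f s = betaToAlpha (g s)
    rw [h1]
    exact (congrArg Subtype.val (ι.symm_apply_apply (r ⟨s, hs⟩))).symm.trans
      (betaToAlpha_unit _).symm

theorem FW.onePoint_separating : (FW.incl (OnePoint ℕ)).Separating :=
  FW.incl_separating fun x y hne => by
    induction x using OnePoint.rec with
    | coe n => exact ⟨_, OnePoint.isClopen_singleton_coe n, Or.inl ⟨rfl, fun h => hne h.symm⟩⟩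
    | infty =>
      induction y using OnePoint.rec with
      | coe n => exact ⟨_, OnePoint.isClopen_singleton_coe n, Or.inr ⟨rfl, hne⟩⟩
      | infty => exact absurd rfl hne

theorem isMuQFHull_finRange_onePoint :
    IsMuQFHull ((CW.pullback betaToAlpha).comp (FW.incl (OnePoint ℕ))) :=
  FW.onePoint_separating.isMuQFHull_pullback FW.incl_injective _ isQuasiFCover_betaToAlpha

/-- The embedding of `F(αℕ)` into `C(βℕ)` in terms of values. -/
theorem pullback_incl_apply (d : FW (OnePoint ℕ)) (x : StoneCech ℕ) :
    ((CW.pullback betaToAlpha).comp (FW.incl (OnePoint ℕ))).fn d x =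
      (FW.incl (OnePoint ℕ)).fn d (betaToAlpha x) := rfl

theorem stoneCech_ext {g h : C(StoneCech ℕ, ℝ)}
    (H : ∀ n : ℕ, g (stoneCechUnit n) = h (stoneCechUnit n)) : g = h :=
  ContinuousMap.ext fun x => congrFun
    (stoneCech_hom_ext g.continuous h.continuous (funext H)) x

/-- Separation holds only on `αℕ`, so the density argument on `βℕ` is not available. Instead, a
nonzero `b` is nonzero at some integer `n`, and `b n` times the indicator of `n` lies below `|b|` in
absolute value. -/
theorem isEssential_finRange_onePoint :
    ((CW.pullback betaToAlpha).comp (FW.incl (OnePoint ℕ))).IsEssential := by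
  refine WHom.isEssential_of_forall (WHom.injective_of_forall _ fun d hd => ?_) fun b hb => ?_
  · refine WHom.eq_zero_of_injective FW.incl_injective (ContinuousMap.ext (Y := ℝ) fun x => ?_)
    obtain ⟨y, rfl⟩ := betaToAlpha_surjective x
    exact DFunLike.congr_fun (F := C(StoneCech ℕ, ℝ)) hd y
  · obtain ⟨n, hn⟩ : ∃ n : ℕ, b (stoneCechUnit n) ≠ 0 := by
      by_contra! hcon
      exact hb (stoneCech_ext hcon)
    refine ⟨b (stoneCechUnit n) • FW.indicator (OnePoint.isClopen_singleton_coe n),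
      fun h0 => hn ?_, fun x => ?_⟩
    · have h1 := (FW.incl (OnePoint ℕ)).fn_smul (b (stoneCechUnit n))
        (FW.indicator (OnePoint.isClopen_singleton_coe n)) n
      rw [h0, WHom.fn_zero, FW.incl_indicator, Set.indicator_of_mem (Set.mem_singleton _), Pi.one_apply,
        mul_one] at h1
      exact h1.symm
    · rw [pullback_incl_apply, WHom.fn_smul, FW.incl_indicator]
      by_cases hx : betaToAlpha x = n
      · rw [Set.indicator_of_mem (by exact hx), Pi.one_apply, mul_one,
          eq_unit_of_betaToAlpha_eq hx]
      · rw [Set.indicator_of_notMem (by exact hx), mul_zero, abs_zero]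
        exact abs_nonneg _

/-- An object with essential embedding in `C(βℕ)` contains the indicators of the points
of `ℕ`. -/
theorem WHom.IsEssential.exists_indicator_nat {A : WStar.{0}} {f : WHom A (CW (StoneCech ℕ))}
    (hf : f.IsEssential) (n : ℕ) :
    ∃ a, ∀ m : ℕ, f.fn a (stoneCechUnit m) = if m = n then 1 else 0 := by
  have hZ : IsClosed (betaToAlpha ⁻¹' {(n : OnePoint ℕ)})ᶜ :=
    (isOpen_betaToAlpha_fiber n).isClosed_compl
  have := isCompact_iff_compactSpace.mp hZ.isCompact
  -- Restriction to the complement of the point `n` kills the indicator of `n`, so essentiality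
  -- prevents it from being injective on `A`. A nonzero element that it kills is supported at `n`
  -- alone.
  obtain ⟨a, ha, ha0⟩ : ∃ a, CW.restrict hZ (f a) = 0 ∧ a ≠ 0 := by
    by_contra! hcon
    have hinj := hf.2 _ (CW.restrict hZ) (injective_of_forall _ hcon)
    let b : C(StoneCech ℕ, ℝ) := ((CW.pullback betaToAlpha).comp (FW.incl (OnePoint ℕ))).fn
      (FW.indicator (OnePoint.isClopen_singleton_coe n))
    have hb : ∀ x, b x = Set.indicator {(n : OnePoint ℕ)} 1 (betaToAlpha x) := fun x => rfl
    have hb0 : b = 0 := eq_zero_of_injective hinj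
      ((CW.restrict_eq_zero hZ).mpr fun x hx => by rw [hb, Set.indicator_of_notMem (by exact hx)])
    have h1 := hb (stoneCechUnit n)
    rw [hb0, betaToAlpha_unit, Set.indicator_of_mem (Set.mem_singleton _)] at h1
    exact zero_ne_one h1
  have hoff : ∀ m : ℕ, m ≠ n → f.fn a (stoneCechUnit m) = 0 := fun m hm =>
    (CW.restrict_eq_zero hZ).mp ha _ fun h => hm (by
      rwa [Set.mem_preimage, betaToAlpha_unit, Set.mem_singleton_iff, OnePoint.coe_eq_coe] at h)
  have hon : f.fn a (stoneCechUnit n) ≠ 0 := fun h0 => ha0 (eq_zero_of_injective hf.1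
    (stoneCech_ext fun m => by
      by_cases hm : m = n
      · subst hm; exact h0
      · exact hoff m hm))
  refine ⟨(f.fn a (stoneCechUnit n))⁻¹ • a, fun m => ?_⟩
  rw [fn_smul]
  split_ifs with hm
  · subst hm; exact inv_mul_cancel₀ hon
  · rw [hoff m hm, mul_zero]

theorem WHom.IsEssential.exists_eq_finRange {A : WStar.{0}} {f : WHom A (CW (StoneCech ℕ))}
    (hf : f.IsEssential) (d : FW (OnePoint ℕ)) :
    ∃ a, f a = (CW.pullback betaToAlpha).comp (FW.incl (OnePoint ℕ)) d := by
  set δ := (FW.incl (OnePoint ℕ)).fn d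
  choose a ha using fun n => hf.exists_indicator_nat n
  -- The fibre over the value at `∞` is an open neighbourhood of `∞`, hence cofinite. So `d` is a
  -- constant plus a finite combination of indicators of integers.
  have hfin : {n : ℕ | δ n ≠ δ OnePoint.infty}.Finite := by
    have hopen := (FW.isClopen_preimage d (δ OnePoint.infty)).isOpen
    rw [OnePoint.isOpen_iff_of_mem (Set.mem_singleton (δ OnePoint.infty))] at hopen
    exact hopen.2.finite_of_discrete
  refine ⟨δ OnePoint.infty • A.unit +
    ∑ n ∈ hfin.toFinset, (δ n - δ OnePoint.infty) • a n, stoneCech_ext fun m => ?_⟩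
  change f.fn _ (stoneCechUnit m) = δ (betaToAlpha (stoneCechUnit m))
  have hsum : ∀ (T : Finset ℕ) (b : ℕ → A), f.fn (∑ n ∈ T, b n) (stoneCechUnit m) =
      ∑ n ∈ T, f.fn (b n) (stoneCechUnit m) := fun T b =>
    map_sum (AddMonoidHom.mk' (fun b => f.fn b (stoneCechUnit m))
      fun b b' => f.fn_add b b' _) _ _
  rw [betaToAlpha_unit, fn_add, fn_smul, fn_unit, hsum]
  simp only [fn_smul, ha, mul_ite, mul_one, mul_zero, Finset.sum_ite_eq]
  split_ifs with hm
  · ring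
  · have : δ m = δ OnePoint.infty := by simpa using hm
    rw [this, add_zero]

theorem isLeast_finRange_onePoint :
    ∃ h : ((CW.pullback betaToAlpha).comp (FW.incl (OnePoint ℕ))).IsEssential,
      IsLeast (VqF (CW (StoneCech ℕ)))
        ⟨FW (OnePoint ℕ), (CW.pullback betaToAlpha).comp (FW.incl (OnePoint ℕ)), h⟩ :=
  ⟨isEssential_finRange_onePoint, isMuQFHull_finRange_onePoint, fun P _ =>
    EssSub.mk_le _ P fun d => P.essential.exists_eq_finRange d⟩

end BetaNat

end
theorem mainTheorem8 :
    (∃ h : ((CW.pullback betaToAlpha).comp (FW.incl (OnePoint ℕ))).IsEssential,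
      IsLeast (VqF (CW (StoneCech ℕ)))
        ⟨FW (OnePoint ℕ), (CW.pullback betaToAlpha).comp (FW.incl (OnePoint ℕ)), h⟩) ∧
    (∀ (K : Type u) [TopologicalSpace K] [CompactSpace K] [T2Space K],
      ConnectedSpace K → Nontrivial K → IsAlmostP K → ¬ ∃ M, IsLeast (VqF (CW K)) M) ∧
    (∀ (K : Type u) [TopologicalSpace K] [CompactSpace K] [T2Space K],
      IsAlmostP K → IsZeroDim K →
        ∃ h : (FW.incl K).IsEssential, IsLeast (VqF (CW K)) ⟨FW K, FW.incl K, h⟩) :=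
  ⟨isLeast_finRange_onePoint,
    fun K _ _ _ _ _ hK => not_exists_isLeast_of_connected K hK,
    fun K _ _ _ hK hZ => isLeast_finRange_of_zeroDim K hK hZ⟩
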